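/- Let $\gamma>2$ be real and let $C_\gamma\subset\mathbb{R}^2$ be a compact convex set contained in the open square $(-1/2,1/2)^2$ whose boundary coincides, in a small disc $U$ centred at the origin, with the graph of $x\mapsto|x|^\gamma$, and such that outside $\frac12U$ the boundary $\partial C_\gamma$ is smooth with curvature bounded below by a positive constant. Identify the torus $\mathbb{T}^2=\mathbb{R}^2/\mathbb{Z}^2$ with $[-1/2,1/2)^2$. Then there is a constant $c>0$, depending only on $C_\gamma$, such that for every integer $N\ge1$ and all points $u(1),\dots,u(N)\in[-1/2,1/2)^2$ there is a dilated and translated copy $\widetilde C_\gamma=\tau C_\gamma+t$ of $C_\gamma$, with $\tau\in[1/2,1]$ and $t\in\mathbb{R}^2$, such that $$\Bigl|-N|\widetilde C_\gamma|+\sum_{j=1}^N\chi_{\widetilde C_\gamma+\mathbb{Z}^2}(u(j))\Bigr|\ \ge\ c\,N^{1/4}.$$ Here $|\widetilde C_\gamma|$ is the area of $\widetilde C_\gamma$, and $\chi_{\widetilde C_\gamma+\mathbb{Z}^2}$ is the characteristic function of $\widetilde C_\gamma+\mathbb{Z}^2$; that is, the translated copy is taken in the torus. -/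

import Mathlib

open scoped ContDiff

/-- The Euclidean plane. -/
abbrev Plane : Type := EuclideanSpace ℝ (Fin 2)

/-- Near the point `p`, the set `S` is a smooth (that is, `C^∞`) curve, and the curvature of
this curve at `p` is at least `κ`: some neighbourhood of `p` meets `S` in a simple smooth arc
`Γ` parametrized by arc length, with `Γ 0 = p`, whose curvature `‖Γ''(0)‖` is at least `κ`. -/
def SmoothWithCurvatureGE (S : Set Plane) (p : Plane) (κ : ℝ) : Prop :=
  ∃ (Γ : ℝ → Plane) (ε : ℝ) (V : Set Plane),
    0 < ε ∧ IsOpen V ∧ p ∈ V ∧ Γ 0 = p ∧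
    ContDiffOn ℝ ∞ Γ (Set.Ioo (-ε) ε) ∧
    Set.InjOn Γ (Set.Ioo (-ε) ε) ∧
    (∀ s ∈ Set.Ioo (-ε) ε, ‖deriv Γ s‖ = 1) ∧
    S ∩ V = Γ '' Set.Ioo (-ε) ε ∧
    κ ≤ ‖deriv (deriv Γ) 0‖

/-- `C` is a convex body `C_γ`: a planar compact convex set, contained in the open square
`(-1/2, 1/2)²`, whose boundary coincides in a neighbourhood `U = B(0, r)` of the origin with the
graph of `x ↦ |x| ^ γ`, and is smooth with curvature bounded below by a positive constant
outside `(1/2) U = B(0, r / 2)`. -/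
structure IsCGamma (γ : ℝ) (C : Set Plane) : Prop where
  isCompact : IsCompact C
  convex : Convex ℝ C
  subset_square : ∀ p ∈ C, ∀ i, p i ∈ Set.Ioo (-(1 / 2) : ℝ) (1 / 2)
  boundary : ∃ r : ℝ, 0 < r ∧
    frontier C ∩ Metric.ball 0 r = {p : Plane | p 1 = |p 0| ^ γ} ∩ Metric.ball 0 r ∧
    ∃ κ : ℝ, 0 < κ ∧
      ∀ p ∈ frontier C, p ∉ Metric.ball (0 : Plane) (r / 2) →
        SmoothWithCurvatureGE (frontier C) p κ

/-- The copy `τ C + t` of `C`, dilated by `τ` and translated by `t`. -/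
def dilatedTranslate (τ : ℝ) (t : Plane) (C : Set Plane) : Set Plane :=
  (fun x => τ • x + t) '' C

/-- The set `A + ℤ²`. Its points in `[-1/2, 1/2)²` represent the image of `A` in the torus
`ℝ² / ℤ²`. -/
def periodization (A : Set Plane) : Set Plane :=
  {x | ∃ m : Fin 2 → ℤ, x - WithLp.toLp 2 (fun i => (m i : ℝ)) ∈ A}

/-!
# A lower bound for the discrepancy with respect to dilates and translates of `C_γ`

The discrepancy of a fixed dilate `τ C`, as a function of the translation `t`, lives on the torus,
and its Fourier coefficient at a frequency `n ≠ 0` is the exponential sum of the points at `n`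
times the Fourier transform of `τ C` at `n`. If all discrepancies were at most `c N^{1/4}`, Bessel's
inequality (`sum_sq_expSum_mul_le`) would bound the resulting weighted sum of squares by
`c² N^{1/2}` for every `τ`. Two lower bounds contradict this for small `c`.

* *Exponential sums.* By the Cassels–Montgomery argument (`exists_le_sum_sq_expSum`), the squares of
  the exponential sums over differences of frequencies in a box with `X² ≥ 2 N` elements, relative to
  a suitable one of them, add up to at least `N X² / 2`. Only multiples of a fixed integer `q` are
  used as frequencies, so that bounds for the Fourier transform at large frequencies suffice.
* *Fourier transform.* In every direction, the square of the Fourier transform of `τ C` at `ξ`,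
  averaged over `τ ∈ [1/2, 1]`, is at least a constant times `|ξ|⁻³`
  (`IsCGamma.exists_le_integral_fourier`).

For the second bound, the Fourier transform of `C` in a given direction is the one-dimensional
Fourier transform of the length of the sections orthogonal to it, a concave function `F` on an
interval, rescaled to `[0, L]`. Since `F'' ≤ 0`, one may test it against any function that dominates
a concave function and vanishes at both ends (`ConcaveOn.integral_mul_deriv2_nonpos`). For large `L`
there is such a test function whose frequencies lie in the band `1/2 ≤ |τ| ≤ 1`
(`ConcaveOn.integral_mul_bandKernel_le`); by the Cauchy–Schwarz inequality the average over `τ` is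
thus bounded below by the square of one section length, at distance `1/|ξ|` from the boundary
(`sq_sectionLength_le_integral_fourier`). Such a section has length at least a constant times
`|ξ|^{-1/2}` as soon as the boundary curvature is bounded above, uniformly over the boundary. This
holds for `C_γ` (`IsCGamma.exists_twoSidedTangent`): near the origin because `γ > 2`, elsewhere
because the boundary is smooth. The flat point at the origin only makes sections longer.
-/

/-! ### Weak concavity -/

open MeasureTheory Set in
/-- The midpoint rule overestimates the integral of a concave function. -/
theorem ConcaveOn.integral_le_midpoint {F : ℝ → ℝ} {x y : ℝ} (hxy : x ≤ y)
    (hF : ConcaveOn ℝ (Icc x y) F) (hint : IntervalIntegrable F volume x y) :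
    ∫ s in x..y, F s ≤ (y - x) * F ((x + y) / 2) := by
  have h1 : ∫ s in x..y, F s = ∫ s in x..y, F (x + y - s) := by
    rw [intervalIntegral.integral_comp_sub_left]; simp
  have hint2 : IntervalIntegrable (fun s => F (x + y - s)) volume x y := by
    have := hint.symm.comp_sub_left (x + y)
    simpa using this
  have h2 : ∫ s in x..y, (F s + F (x + y - s)) ≤ ∫ s in x..y, 2 * F ((x + y) / 2) := by
    refine intervalIntegral.integral_mono_on hxy (hint.add hint2) (by simp) fun s hs => ?_
    have := hF.2 hs (show x + y - s ∈ Icc x y from ⟨by linarith [hs.2], by linarith [hs.1]⟩)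
      (show (0 : ℝ) ≤ 1 / 2 by norm_num) (show (0 : ℝ) ≤ 1 / 2 by norm_num) (by norm_num)
    simp only [smul_eq_mul] at this
    rw [show 1 / 2 * s + 1 / 2 * (x + y - s) = (x + y) / 2 by ring] at this
    linarith
  rw [intervalIntegral.integral_add hint hint2, ← h1] at h2
  simp only [intervalIntegral.integral_const, smul_eq_mul] at h2
  linarith

open MeasureTheory Set in
/-- Integration by parts on one cell: a concave function is replaced by its chord, at the cost of
a midpoint second difference. -/
theorem ConcaveOn.integral_mul_le_chord {F φ φ' φ'' : ℝ → ℝ} {x y K : ℝ} (hxy : x < y) (hK0 : 0 ≤ K)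
    (hF : ConcaveOn ℝ (Icc x y) F) (hint : IntervalIntegrable F volume x y)
    (hφ : ∀ s, HasDerivAt φ (φ' s) s) (hφ' : ∀ s, HasDerivAt φ' (φ'' s) s)
    (hc : Continuous φ'') (hK : ∀ s ∈ Icc x y, φ'' s ≤ K) :
    ∫ s in x..y, F s * φ'' s ≤
      (F y * φ' y - F x * φ' x - (F y - F x) / (y - x) * (φ y - φ x)) +
        K * ((y - x) / 2 * (2 * F ((x + y) / 2) - F x - F y)) := by
  have hyx : 0 < y - x := by linarith
  set m := (F y - F x) / (y - x) with hm
  set l : ℝ → ℝ := fun s => F x + m * (s - x) with hl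
  have hly : l y = F y := by simp only [hl, hm]; field_simp; ring
  have hlx : l x = F x := by simp [hl]
  have hlc : Continuous l := by fun_prop
  have hld : ∀ s, HasDerivAt l m s := fun s => by
    simpa [hl] using (((hasDerivAt_id s).sub_const x).const_mul m).const_add (F x)
  have hlF : ∀ s ∈ Icc x y, l s ≤ F s := fun s hs => by
    have := hF.2 (left_mem_Icc.2 hxy.le) (right_mem_Icc.2 hxy.le)
      (show 0 ≤ (y - s) / (y - x) from div_nonneg (by linarith [hs.2]) hyx.le)
      (show 0 ≤ (s - x) / (y - x) from div_nonneg (by linarith [hs.1]) hyx.le)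
      (by field_simp; ring)
    simp only [smul_eq_mul] at this
    rw [show (y - s) / (y - x) * x + (s - x) / (y - x) * y = s by field_simp; ring] at this
    refine le_trans (le_of_eq ?_) this
    simp only [hl, hm]; field_simp; ring
  have hφc : Continuous φ' := continuous_iff_continuousAt.2 fun s => (hφ' s).continuousAt
  have hparts : ∫ s in x..y, l s * φ'' s = F y * φ' y - F x * φ' x - m * (φ y - φ x) := by
    rw [intervalIntegral.integral_mul_deriv_eq_deriv_mul (fun s _ => hld s) (fun s _ => hφ' s)
      (by simp) (hc.intervalIntegrable _ _), hly, hlx, intervalIntegral.integral_const_mul,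
      intervalIntegral.integral_eq_sub_of_hasDerivAt (fun s _ => hφ s)
        (hφc.intervalIntegrable _ _)]
  have hlint : ∫ s in x..y, l s = (y - x) / 2 * (F x + F y) := by
    have := intervalIntegral.integral_mul_deriv_eq_deriv_mul (a := x) (b := y)
      (fun s _ => hld s) (fun s _ => (hasDerivAt_id s).sub_const ((x + y) / 2))
      (by simp) (by simp)
    simp only [id, mul_one, hly, hlx, intervalIntegral.integral_const_mul] at this
    rw [this, intervalIntegral.integral_sub (by simp) (by simp)]
    simp; ring
  have hmono : ∫ s in x..y, (F s - l s) * φ'' s ≤ ∫ s in x..y, K * (F s - l s) := by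
    refine intervalIntegral.integral_mono_on hxy.le
      ((hint.sub (hlc.intervalIntegrable _ _)).mul_continuousOn hc.continuousOn)
      ((hint.sub (hlc.intervalIntegrable _ _)).const_mul _) fun s hs => ?_
    rw [mul_comm]
    exact mul_le_mul_of_nonneg_right (hK s hs) (by linarith [hlF s hs])
  have hsplit : ∫ s in x..y, F s * φ'' s =
      (∫ s in x..y, l s * φ'' s) + ∫ s in x..y, (F s - l s) * φ'' s := by
    rw [← intervalIntegral.integral_add]
    · congr 1; ext s; ring
    · exact (hlc.mul hc).intervalIntegrable _ _
    · exact (hint.sub (hlc.intervalIntegrable _ _)).mul_continuousOn hc.continuousOn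
  have hmid := hF.integral_le_midpoint hxy.le hint
  have hF0 : ∫ s in x..y, (F s - l s) ≤ (y - x) / 2 * (2 * F ((x + y) / 2) - F x - F y) := by
    rw [intervalIntegral.integral_sub hint (hlc.intervalIntegrable _ _), hlint]; linarith
  rw [hsplit, hparts]
  rw [intervalIntegral.integral_const_mul] at hmono
  have := mul_le_mul_of_nonneg_left hF0 hK0
  linarith

open MeasureTheory Set in
/-- A nonnegative concave function on `[0, L]` has nonpositive second derivative in the weak sense,
also when tested against functions that vanish only to first order at the end points. -/
theorem ConcaveOn.integral_mul_deriv2_nonpos {L : ℝ} (hL : 0 < L) {F φ φ' φ'' : ℝ → ℝ}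
    (hF : ConcaveOn ℝ (Icc 0 L) F) (hF0 : ∀ s ∈ Icc 0 L, 0 ≤ F s)
    {B : ℝ} (hB : ∀ s ∈ Icc 0 L, F s ≤ B) (hint : IntervalIntegrable F volume 0 L)
    (hφ : ∀ s, HasDerivAt φ (φ' s) s) (hφ' : ∀ s, HasDerivAt φ' (φ'' s) s)
    (hc : Continuous φ'') (hφ0 : φ 0 = 0) (hφL : φ L = 0) (hpos : ∀ s ∈ Icc 0 L, 0 ≤ φ s) :
    ∫ s in (0 : ℝ)..L, F s * φ'' s ≤ 0 := by
  obtain ⟨K, hK0, hK⟩ : ∃ K, 0 ≤ K ∧ ∀ s ∈ Icc 0 L, φ'' s ≤ K := by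
    obtain ⟨K, hK⟩ := (isCompact_Icc (a := (0 : ℝ)) (b := L)).exists_bound_of_continuousOn
      hc.continuousOn
    exact ⟨max K 0, le_max_right _ _, fun s hs =>
      (le_abs_self _).trans ((hK s hs).trans (le_max_left _ _))⟩
  -- the end point derivatives have the favourable sign because `φ ≥ 0` vanishes there
  have hd0 : 0 ≤ φ' 0 := by
    by_contra! h
    have h1 : ∀ᶠ s in nhdsWithin (0 : ℝ) (Ioi 0), φ s < φ 0 := by
      have := (hφ 0).tendsto_slope.eventually (gt_mem_nhds h)
      have h2 : nhdsWithin (0 : ℝ) (Ioi 0) ≤ nhdsWithin (0 : ℝ) {0}ᶜ :=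
        nhdsWithin_mono _ fun x hx => ne_of_gt hx
      filter_upwards [h2 this, self_mem_nhdsWithin] with s hs hs0
      rw [slope_def_field, div_neg_iff] at hs
      rcases hs with hs | hs
      · have : (0 : ℝ) < s := hs0
        linarith
      · linarith
    obtain ⟨s, hs1, hs2⟩ := (h1.and (Ioo_mem_nhdsGT hL)).exists
    linarith [hpos s ⟨hs2.1.le, hs2.2.le⟩]
  have hdL : φ' L ≤ 0 := by
    by_contra! h
    have h1 : ∀ᶠ s in nhdsWithin L (Iio L), φ s < φ L := by
      have := (hφ L).tendsto_slope.eventually (lt_mem_nhds h)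
      have h2 : nhdsWithin L (Iio L) ≤ nhdsWithin L {L}ᶜ :=
        nhdsWithin_mono _ fun x hx => ne_of_lt hx
      filter_upwards [h2 this, self_mem_nhdsWithin] with s hs hs0
      rw [slope_def_field, div_pos_iff] at hs
      rcases hs with hs | hs
      · have : s < L := hs0
        linarith
      · linarith
    obtain ⟨s, hs1, hs2⟩ := (h1.and (Ioo_mem_nhdsLT hL)).exists
    linarith [hpos s ⟨hs2.1.le, hs2.2.le⟩]
  have hB0 : 0 ≤ B := (hF0 0 ⟨le_rfl, hL.le⟩).trans (hB 0 ⟨le_rfl, hL.le⟩)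
  -- the bound with an error for a partition into `n + 1` cells of length `ε`
  have key : ∀ n : ℕ, ∫ s in (0 : ℝ)..L, F s * φ'' s ≤ K * B * L / (n + 1) := by
    intro n
    set ε := L / (n + 1) with hε
    have hn : (0 : ℝ) < n + 1 := by positivity
    have hε0 : 0 < ε := by positivity
    have hεL : ε * (n + 1) = L := by simp only [hε]; field_simp
    have step : ∀ k : ℕ, k ≤ n →
        ∫ s in (0 : ℝ)..(ε * (k + 1)), F s * φ'' s ≤
          F (ε * (k + 1)) * φ' (ε * (k + 1)) - F 0 * φ' 0 -
            (F (ε * (k + 1)) - F (ε * k)) / ε * φ (ε * (k + 1)) +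
          K * (ε / 2 * (F (ε / 2) - F 0 + F (ε * k + ε / 2) - F (ε * (k + 1)))) := by
      have cell : ∀ k : ℕ, k ≤ n → ε * k ∈ Icc 0 L ∧ ε * (k + 1) ∈ Icc 0 L ∧
          ε * k < ε * (k + 1) ∧ ε * k + ε / 2 ∈ Icc 0 L := by
        intro k hk
        have hk' : (k : ℝ) ≤ n := by exact_mod_cast hk
        have h1 : ε * (k + 1) ≤ L := by rw [← hεL]; gcongr
        have h2 : 0 ≤ ε * k := by positivity
        refine ⟨⟨h2, ?_⟩, ⟨?_, h1⟩, ?_, ⟨?_, ?_⟩⟩ <;> linarith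
      intro k
      induction k with
      | zero =>
        intro hk
        obtain ⟨h0, h1, h2, h3⟩ := cell 0 hk
        have := ConcaveOn.integral_mul_le_chord h2 hK0 (hF.subset (Icc_subset_Icc h0.1 h1.2)
          (convex_Icc _ _)) (hint.mono_set (by
            rw [uIcc_of_le h2.le, uIcc_of_le hL.le]; exact Icc_subset_Icc h0.1 h1.2))
          hφ hφ' hc (fun s hs => hK s ⟨h0.1.trans hs.1, hs.2.trans h1.2⟩)
        simp only [Nat.cast_zero, mul_zero, zero_add, mul_one, sub_zero, hφ0] at this ⊢
        refine this.trans (le_of_eq ?_)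
        ring
      | succ k ih =>
        intro hk
        obtain ⟨h0, h1, h2, h3⟩ := cell (k + 1) hk
        obtain ⟨g0, g1, g2, g3⟩ := cell k (by omega)
        have := ConcaveOn.integral_mul_le_chord h2 hK0 (hF.subset (Icc_subset_Icc h0.1 h1.2)
          (convex_Icc _ _)) (hint.mono_set (by
            rw [uIcc_of_le h2.le, uIcc_of_le hL.le]; exact Icc_subset_Icc h0.1 h1.2))
          hφ hφ' hc (fun s hs => hK s ⟨h0.1.trans hs.1, hs.2.trans h1.2⟩)
        have ih := ih (by omega)
        have hadd := intervalIntegral.integral_add_adjacent_intervals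
          (μ := volume) (f := fun s => F s * φ'' s) (a := 0) (b := ε * (k + 1))
          (c := ε * (k + 1 + 1))
          ((hint.mono_set (by
            rw [uIcc_of_le g1.1, uIcc_of_le hL.le]
            exact Icc_subset_Icc le_rfl g1.2)).mul_continuousOn hc.continuousOn)
          ((hint.mono_set (by
            push_cast at h0 h1 h2
            rw [uIcc_of_le h2.le, uIcc_of_le hL.le]
            exact Icc_subset_Icc h0.1 h1.2)).mul_continuousOn hc.continuousOn)
        push_cast at this h0 h1 h2 h3 ⊢
        rw [← hadd]
        -- concavity at the node and at the midpoints around it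
        have c1 : F (ε * (k + 1 + 1)) - F (ε * (k + 1)) ≤ F (ε * (k + 1)) - F (ε * k) := by
          have := hF.2 g0 h1 (show (0 : ℝ) ≤ 1 / 2 by norm_num)
            (show (0 : ℝ) ≤ 1 / 2 by norm_num) (by norm_num)
          simp only [smul_eq_mul] at this
          rw [show 1 / 2 * (ε * k) + 1 / 2 * (ε * (k + 1 + 1)) = ε * (k + 1) by ring] at this
          linarith
        have c2 : F (ε * (k + 1) + ε / 2) + F (ε * k + ε / 2) ≤ 2 * F (ε * (k + 1)) := by
          have := hF.2 g3 h3 (show (0 : ℝ) ≤ 1 / 2 by norm_num)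
            (show (0 : ℝ) ≤ 1 / 2 by norm_num) (by norm_num)
          simp only [smul_eq_mul] at this
          rw [show 1 / 2 * (ε * k + ε / 2) + 1 / 2 * (ε * (k + 1) + ε / 2) = ε * (k + 1) by ring]
            at this
          linarith
        have c3 : (F (ε * (k + 1 + 1)) - F (ε * (k + 1))) / ε * φ (ε * (k + 1)) ≤
            (F (ε * (k + 1)) - F (ε * k)) / ε * φ (ε * (k + 1)) := by
          have := hpos _ g1
          gcongr
        have c4 := mul_le_mul_of_nonneg_left c2 (show 0 ≤ K * (ε / 2) by positivity)
        rw [show ε * ((k : ℝ) + 1 + 1) - ε * (k + 1) = ε by ring,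
          show (ε * ((k : ℝ) + 1) + ε * (k + 1 + 1)) / 2 = ε * (k + 1) + ε / 2 by ring] at this
        linarith
    have h := step n le_rfl
    rw [hεL, hφL, mul_zero, sub_zero] at h
    have hhalf : ε / 2 ≤ L := by
      have : ε * 1 ≤ ε * (n + 1) := by gcongr; linarith [Nat.cast_nonneg (α := ℝ) n]
      linarith
    have hm1 := hB (ε / 2) ⟨by positivity, hhalf⟩
    have hm2 := hB (ε * n + ε / 2) ⟨by positivity, by linarith⟩
    have hz := hF0 0 ⟨le_rfl, hL.le⟩
    have hzL := hF0 L ⟨hL.le, le_rfl⟩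
    have e1 : K * (ε / 2 * (F (ε / 2) - F 0 + F (ε * n + ε / 2) - F L)) ≤ K * (ε / 2 * (2 * B)) := by
      gcongr; linarith
    have e2 : F L * φ' L ≤ 0 := mul_nonpos_of_nonneg_of_nonpos hzL hdL
    have e3 : 0 ≤ F 0 * φ' 0 := mul_nonneg hz hd0
    have e4 : K * (ε / 2 * (2 * B)) = K * B * L / (n + 1) := by simp only [hε]; ring
    linarith
  have hlim : Filter.Tendsto (fun n : ℕ => K * B * L / ((n : ℝ) + 1)) Filter.atTop (nhds 0) :=
    by simpa [div_eq_mul_inv] using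
      (tendsto_one_div_add_atTop_nhds_zero_nat (𝕜 := ℝ)).const_mul (K * B * L)
  exact ge_of_tendsto' hlim key

/-! ### A band-limited test function -/

open MeasureTheory Set Real in
/-- Differentiation under the integral sign for trigonometric integrals over `[1/2, 1]`. -/
theorem hasDerivAt_integral_trig (p : ℝ → ℝ) (hp : Continuous p) (a b s : ℝ) :
    HasDerivAt (fun s => ∫ τ in (1 / 2 : ℝ)..1, p τ * (a * cos (τ * s) + b * sin (τ * s)))
      (∫ τ in (1 / 2 : ℝ)..1, p τ * τ * (b * cos (τ * s) - a * sin (τ * s))) s := by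
  have hd : ∀ τ s : ℝ, HasDerivAt (fun s => p τ * (a * cos (τ * s) + b * sin (τ * s)))
      (p τ * τ * (b * cos (τ * s) - a * sin (τ * s))) s := fun τ s => by
    have h1 : HasDerivAt (fun s => τ * s) τ s := by simpa using (hasDerivAt_id s).const_mul τ
    exact (((h1.cos.const_mul a).add (h1.sin.const_mul b)).const_mul (p τ)).congr_deriv (by ring)
  refine (intervalIntegral.hasDerivAt_integral_of_dominated_loc_of_deriv_le (𝕜 := ℝ) (E := ℝ)
    (F := fun s τ => p τ * (a * cos (τ * s) + b * sin (τ * s)))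
    (F' := fun s τ => p τ * τ * (b * cos (τ * s) - a * sin (τ * s)))
    (bound := fun τ => |p τ * τ| * (|b| + |a|)) Filter.univ_mem ?_ ?_ ?_ ?_ ?_ ?_).2
  · exact Filter.Eventually.of_forall fun x =>
      (by fun_prop : Continuous fun τ => p τ * (a * cos (τ * x) + b * sin (τ * x)))
        |>.aestronglyMeasurable
  · exact (by fun_prop : Continuous fun τ => p τ * (a * cos (τ * s) + b * sin (τ * s)))
      |>.intervalIntegrable _ _
  · exact (by fun_prop : Continuous fun τ => p τ * τ * (b * cos (τ * s) - a * sin (τ * s)))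
      |>.aestronglyMeasurable
  · refine Filter.Eventually.of_forall fun τ _ x _ => ?_
    rw [norm_eq_abs, abs_mul]
    gcongr
    refine (abs_sub _ _).trans ?_
    rw [abs_mul, abs_mul]
    gcongr
    · exact mul_le_of_le_one_right (abs_nonneg _) (abs_cos_le_one _)
    · exact mul_le_of_le_one_right (abs_nonneg _) (abs_sin_le_one _)
  · exact (by fun_prop : Continuous fun τ => |p τ * τ| * (|b| + |a|)) |>.intervalIntegrable _ _
  · exact Filter.Eventually.of_forall fun τ _ x _ => hd τ x

open Real in
/-- The second antiderivative `s ↦ ∫ (20 (1 - cos τs) + sin τs) dτ`, over `[1/2, 1]`, of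
`bandKernel`. The sine makes it grow linearly at the origin; the factor `20` is large enough for the
average of `1 - cos` to outweigh the sine away from the origin. -/
noncomputable def bandPotential (s : ℝ) : ℝ :=
  10 + ∫ τ in (1 / 2 : ℝ)..1, 1 * (-20 * cos (τ * s) + 1 * sin (τ * s))

open Real in
/-- The derivative of `bandPotential`. -/
noncomputable def bandPotentialDeriv (s : ℝ) : ℝ :=
  ∫ τ in (1 / 2 : ℝ)..1, 1 * τ * (1 * cos (τ * s) - -20 * sin (τ * s))

open Real in
/-- The kernel `s ↦ ∫ τ² (20 cos τs - sin τs) dτ`, over `[1/2, 1]`, whose frequencies lie in the bands `1/2 ≤ |τ| ≤ 1`. -/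
noncomputable def bandKernel (s : ℝ) : ℝ :=
  ∫ τ in (1 / 2 : ℝ)..1, τ ^ 2 * (20 * cos (τ * s) - sin (τ * s))

theorem hasDerivAt_bandPotential (s : ℝ) :
    HasDerivAt bandPotential (bandPotentialDeriv s) s :=
  (hasDerivAt_integral_trig (fun _ => 1) continuous_const (-20) 1 s).const_add 10

open Real in
theorem hasDerivAt_bandPotentialDeriv (s : ℝ) :
    HasDerivAt bandPotentialDeriv (bandKernel s) s := by
  have := hasDerivAt_integral_trig (fun τ => τ) continuous_id 1 20 s
  convert this using 1
  · ext s; simp only [bandPotentialDeriv]; congr 1; ext τ; ring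
  · simp only [bandKernel]; congr 1; ext τ; ring

open Real in
theorem bandPotential_zero : bandPotential 0 = 0 := by
  simp [bandPotential]; norm_num

open Real MeasureTheory in
theorem continuous_bandKernel : Continuous bandKernel := by
  unfold bandKernel
  exact intervalIntegral.continuous_parametric_intervalIntegral_of_continuous
    (f := fun s τ => τ ^ 2 * (20 * cos (τ * s) - sin (τ * s))) (by fun_prop) continuous_const

open Real MeasureTheory in
theorem integral_cos_band {s : ℝ} (hs : s ≠ 0) :
    ∫ τ in (1 / 2 : ℝ)..1, cos (τ * s) = (sin s - sin (s / 2)) / s := by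
  rw [intervalIntegral.integral_comp_mul_right cos hs, integral_cos]
  simp only [one_mul, smul_eq_mul]
  rw [show 1 / 2 * s = s / 2 by ring]
  field_simp

open Real MeasureTheory in
theorem integral_sin_band {s : ℝ} (hs : s ≠ 0) :
    ∫ τ in (1 / 2 : ℝ)..1, sin (τ * s) = (cos (s / 2) - cos s) / s := by
  rw [intervalIntegral.integral_comp_mul_right sin hs, integral_sin]
  simp only [one_mul, smul_eq_mul]
  rw [show 1 / 2 * s = s / 2 by ring]
  field_simp

open Real MeasureTheory in
theorem bandPotential_eq (s : ℝ) : bandPotential s =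
    20 * (1 / 2 - ∫ τ in (1 / 2 : ℝ)..1, cos (τ * s)) + ∫ τ in (1 / 2 : ℝ)..1, sin (τ * s) := by
  have h : ∀ τ : ℝ, 1 * (-20 * cos (τ * s) + 1 * sin (τ * s)) =
    -20 * cos (τ * s) + sin (τ * s) := fun τ => by ring
  simp only [bandPotential, h]
  rw [intervalIntegral.integral_add, intervalIntegral.integral_const_mul]
  · ring
  · exact (by fun_prop : Continuous fun τ => -20 * cos (τ * s)).intervalIntegrable _ _
  · exact (by fun_prop : Continuous fun τ => sin (τ * s)).intervalIntegrable _ _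

open Real in
theorem abs_bandPotential_sub_le {x : ℝ} (hx : 0 < x) : |bandPotential x - 10| ≤ 42 / x := by
  rw [bandPotential_eq, integral_cos_band hx.ne', integral_sin_band hx.ne',
    show 20 * (1 / 2 - (sin x - sin (x / 2)) / x) + (cos (x / 2) - cos x) / x - 10 =
      (-20 * sin x + 20 * sin (x / 2) + cos (x / 2) - cos x) / x by field_simp; ring, abs_div,
    abs_of_pos hx]
  gcongr
  rw [abs_le]
  constructor <;> linarith [sin_le_one x, neg_one_le_sin x, sin_le_one (x / 2),
    neg_one_le_sin (x / 2), cos_le_one x, neg_one_le_cos x, cos_le_one (x / 2),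
    neg_one_le_cos (x / 2)]

open Real MeasureTheory in
theorem abs_bandPotentialDeriv_le {x : ℝ} (hx : 0 < x) : |bandPotentialDeriv x| ≤ 63 / x := by
  -- integrate by parts in `τ`
  have hparts := intervalIntegral.integral_mul_deriv_eq_deriv_mul (a := (1 / 2 : ℝ)) (b := 1)
    (u := fun τ => τ) (u' := fun _ => 1) (v := fun τ => (sin (τ * x) - 20 * cos (τ * x)) / x)
    (v' := fun τ => cos (τ * x) + 20 * sin (τ * x)) (fun τ _ => hasDerivAt_id τ)
    (fun τ _ => by
      have h1 : HasDerivAt (fun τ => τ * x) x τ := by simpa using (hasDerivAt_id τ).mul_const x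
      exact ((h1.sin.sub (h1.cos.const_mul 20)).div_const x).congr_deriv (by field_simp; ring))
    (by simp) ((by fun_prop : Continuous fun τ => cos (τ * x) + 20 * sin (τ * x)).intervalIntegrable
      _ _)
  have hrem : ‖∫ τ in (1 / 2 : ℝ)..1, 1 * ((sin (τ * x) - 20 * cos (τ * x)) / x)‖ ≤
      21 / x * |1 - 1 / 2| := by
    refine intervalIntegral.norm_integral_le_of_norm_le_const fun τ _ => ?_
    rw [one_mul, norm_eq_abs, abs_div, abs_of_pos hx]
    gcongr
    rw [abs_le]
    constructor <;> linarith [sin_le_one (τ * x), neg_one_le_sin (τ * x), cos_le_one (τ * x),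
      neg_one_le_cos (τ * x)]
  have heq : bandPotentialDeriv x = ∫ τ in (1 / 2 : ℝ)..1, τ * (cos (τ * x) + 20 * sin (τ * x)) := by
    simp only [bandPotentialDeriv]; congr 1; ext τ; ring
  rw [heq, hparts]
  have h1 : |1 * ((sin (1 * x) - 20 * cos (1 * x)) / x) -
      1 / 2 * ((sin (1 / 2 * x) - 20 * cos (1 / 2 * x)) / x)| ≤ 32 / x := by
    rw [show 1 * ((sin (1 * x) - 20 * cos (1 * x)) / x) -
      1 / 2 * ((sin (1 / 2 * x) - 20 * cos (1 / 2 * x)) / x) = (sin (1 * x) - 20 * cos (1 * x) -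
      1 / 2 * (sin (1 / 2 * x) - 20 * cos (1 / 2 * x))) / x by ring, abs_div, abs_of_pos hx]
    gcongr
    rw [abs_le]
    constructor <;> linarith [sin_le_one (1 * x), neg_one_le_sin (1 * x), cos_le_one (1 * x),
      neg_one_le_cos (1 * x), sin_le_one (1 / 2 * x), neg_one_le_sin (1 / 2 * x),
      cos_le_one (1 / 2 * x), neg_one_le_cos (1 / 2 * x)]
  refine (abs_sub _ _).trans ?_
  rw [norm_eq_abs] at hrem
  have h2 : (21 : ℝ) / x * |1 - 1 / 2| = 21 / 2 / x := by
    rw [show (1 : ℝ) - 1 / 2 = 1 / 2 by norm_num, abs_of_pos (by norm_num : (0 : ℝ) < 1 / 2)]; ring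
  have h3 : 32 / x + 21 / 2 / x ≤ 63 / x := by rw [← add_div]; gcongr; norm_num
  linarith

open Real MeasureTheory in
/-- Averaging over a full band keeps `1 - cos` away from zero. -/
theorem integral_cos_band_le {s : ℝ} (hs : 1 ≤ s) :
    ∫ τ in (1 / 2 : ℝ)..1, cos (τ * s) ≤ 1 / 2 - 1 / 25 := by
  have hs0 : 0 < s := by linarith
  have hπ := pi_gt_three
  have hπ' := pi_lt_d2
  rcases le_or_gt s 3 with h3 | h3
  · have hm : ∫ τ in (1 / 2 : ℝ)..1, cos (τ * s) ≤ ∫ τ in (1 / 2 : ℝ)..1, (1 - 1 / 5 * (τ * τ)) := by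
      refine intervalIntegral.integral_mono_on (by norm_num)
        ((by fun_prop : Continuous fun τ => cos (τ * s)).intervalIntegrable _ _)
        ((by fun_prop : Continuous fun τ : ℝ => 1 - 1 / 5 * (τ * τ)).intervalIntegrable _ _)
        fun τ hτ => ?_
      have h1 : |τ * s| ≤ π := by
        rw [abs_of_nonneg (by nlinarith [hτ.1])]
        nlinarith [hτ.1, hτ.2]
      have h2 := cos_le_one_sub_mul_cos_sq h1
      have h4 : (1 : ℝ) / 5 ≤ 2 / π ^ 2 := by
        rw [div_le_div_iff₀ (by norm_num) (by positivity)]; nlinarith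
      have h5 : τ * τ ≤ (τ * s) ^ 2 := by
        rw [mul_pow, ← pow_two]
        exact le_mul_of_one_le_right (sq_nonneg τ) (one_le_pow₀ hs)
      have h6 : 1 / 5 * (τ * τ) ≤ 2 / π ^ 2 * (τ * s) ^ 2 := by
        have := mul_self_nonneg τ
        gcongr
      linarith
    refine hm.trans ?_
    rw [intervalIntegral.integral_sub (by simp)
      ((by fun_prop : Continuous fun τ : ℝ => 1 / 5 * (τ * τ)).intervalIntegrable _ _),
      intervalIntegral.integral_const_mul]
    have : ∫ τ in (1 / 2 : ℝ)..1, τ * τ = 7 / 24 := by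
      have : ∀ τ : ℝ, τ * τ = τ ^ 2 := fun τ => by ring
      simp only [this, integral_pow]; norm_num
    rw [this]; norm_num
  · rw [integral_cos_band hs0.ne']
    have hfac : sin s - sin (s / 2) = 2 * sin (s / 4) * cos (3 * s / 4) := by
      rw [sin_sub_sin]; congr 2 <;> ring_nf
    rcases le_or_gt s 5 with h5 | h5
    · rw [hfac]
      have hc : cos (3 * s / 4) ≤ 0 :=
        cos_nonpos_of_pi_div_two_le_of_le (by linarith) (by linarith)
      have hsn : 0 ≤ sin (s / 4) := sin_nonneg_of_nonneg_of_le_pi (by linarith) (by linarith)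
      have : 2 * sin (s / 4) * cos (3 * s / 4) / s ≤ 0 :=
        div_nonpos_of_nonpos_of_nonneg (mul_nonpos_of_nonneg_of_nonpos (by linarith) hc) hs0.le
      linarith
    · rw [div_le_iff₀ hs0]
      nlinarith [sin_le_one s, neg_one_le_sin (s / 2)]

open Real MeasureTheory in
theorem le_bandPotential {s : ℝ} (hs : 0 ≤ s) : 1 / 5 * min s 1 ≤ bandPotential s := by
  rw [bandPotential_eq]
  have hπ := pi_lt_d2
  rcases le_or_gt s 1 with h | h
  · have h1 : ∫ τ in (1 / 2 : ℝ)..1, cos (τ * s) ≤ ∫ τ in (1 / 2 : ℝ)..1, (1 : ℝ) :=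
      intervalIntegral.integral_mono_on (by norm_num)
        ((by fun_prop : Continuous fun τ => cos (τ * s)).intervalIntegrable _ _) (by simp)
        fun τ _ => cos_le_one _
    have h2 : ∫ τ in (1 / 2 : ℝ)..1, 3 / 5 * s * τ ≤ ∫ τ in (1 / 2 : ℝ)..1, sin (τ * s) := by
      refine intervalIntegral.integral_mono_on (by norm_num)
        ((by fun_prop : Continuous fun τ => 3 / 5 * s * τ).intervalIntegrable _ _)
        ((by fun_prop : Continuous fun τ => sin (τ * s)).intervalIntegrable _ _) fun τ hτ => ?_
      have h0 : 0 ≤ τ * s := mul_nonneg (by linarith [hτ.1]) hs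
      have := mul_le_sin h0 (by nlinarith [hτ.1, hτ.2, pi_gt_three])
      refine le_trans ?_ this
      rw [show 3 / 5 * s * τ = 3 / 5 * (τ * s) by ring]
      refine mul_le_mul_of_nonneg_right ?_ h0
      rw [div_le_div_iff₀ (by norm_num) pi_pos]; linarith
    rw [intervalIntegral.integral_const_mul, integral_id] at h2
    rw [intervalIntegral.integral_const, smul_eq_mul] at h1
    rw [min_eq_left h]
    linarith
  · have h1 := integral_cos_band_le h.le
    have h2 : ∫ τ in (1 / 2 : ℝ)..1, (-1 : ℝ) ≤ ∫ τ in (1 / 2 : ℝ)..1, sin (τ * s) :=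
      intervalIntegral.integral_mono_on (by norm_num) (by simp)
        ((by fun_prop : Continuous fun τ => sin (τ * s)).intervalIntegrable _ _)
        fun τ _ => neg_one_le_sin _
    rw [intervalIntegral.integral_const, smul_eq_mul] at h2
    rw [min_eq_right h.le]
    linarith

open Real Set in
/-- The symmetrized `bandPotential`, which vanishes at `0` and `L`, dominates a multiple of the
concave function `(1 - e^{-s}) + (1 - e^{-(L-s)}) - (1 - e^{-L})` once `L` is large, because
`bandPotential` grows linearly at the origin and is nearly constant far away. -/
theorem le_bandPotential_add_reflect {L s : ℝ} (hL : 10000 ≤ L) (hs : s ∈ Icc 0 L) :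
    1 / 10 * ((1 - exp (-s)) + (1 - exp (-(L - s))) - (1 - exp (-L))) ≤
      bandPotential s + bandPotential (L - s) - bandPotential L := by
  wlog h : s ≤ L / 2 generalizing s
  · have := this (s := L - s) ⟨by linarith [hs.2], by linarith [hs.1]⟩ (by linarith)
    rw [sub_sub_cancel] at this
    linarith
  have hfar : ∀ x ∈ Icc (L / 2) L, |bandPotentialDeriv x| ≤ 1 / 50 := fun x hx => by
    have hx0 : 0 < x := by linarith [hx.1]
    refine (abs_bandPotentialDeriv_le hx0).trans ?_
    rw [div_le_div_iff₀ hx0 (by norm_num)]; linarith [hx.1]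
  have hsub : bandPotential L - bandPotential (L - s) ≤ 1 / 10 * min s 1 := by
    rw [mul_min_of_nonneg _ _ (by norm_num), le_min_iff]
    constructor
    · have := Convex.norm_image_sub_le_of_norm_hasDerivWithin_le
        (fun x _ => (hasDerivAt_bandPotential x).hasDerivWithinAt) hfar (convex_Icc (L / 2) L)
        (show L - s ∈ Icc (L / 2) L from ⟨by linarith, by linarith [hs.1]⟩)
        (show L ∈ Icc (L / 2) L from ⟨by linarith, le_rfl⟩)
      rw [sub_sub_cancel, norm_eq_abs, norm_eq_abs, abs_of_nonneg hs.1] at this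
      linarith [le_abs_self (bandPotential L - bandPotential (L - s)), hs.1]
    · have hb : ∀ x, L / 2 ≤ x → |bandPotential x - 10| ≤ 1 / 50 := fun x hx => by
        have hx0 : 0 < x := by linarith
        refine (abs_bandPotential_sub_le hx0).trans ?_
        rw [div_le_div_iff₀ hx0 (by norm_num)]; linarith
      have h1 := abs_le.1 (hb L (by linarith))
      have h2 := abs_le.1 (hb (L - s) (by linarith))
      linarith [h1.2, h2.1]
  have h1 := le_bandPotential hs.1
  have h2 : 1 - exp (-s) ≤ min s 1 :=
    le_min (by linarith [add_one_le_exp (-s)]) (by linarith [exp_pos (-s)])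
  have h3 : exp (-L) ≤ exp (-(L - s)) := exp_le_exp.2 (by linarith [hs.1])
  linarith

open MeasureTheory Real Set in
/-- Band-limited test functions detect the size of a concave function near the end point of its
support. -/
theorem ConcaveOn.integral_mul_bandKernel_le {L : ℝ} (hL : 10000 ≤ L) {F : ℝ → ℝ}
    (hF : ConcaveOn ℝ (Icc 0 L) F) (hF0 : ∀ s ∈ Icc 0 L, 0 ≤ F s)
    {B : ℝ} (hB : ∀ s ∈ Icc 0 L, F s ≤ B) (hint : IntervalIntegrable F volume 0 L) :
    1 / 60 * F 1 ≤ -∫ s in (0 : ℝ)..L, F s * (bandKernel s + bandKernel (L - s)) := by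
  have hL0 : 0 < L := by linarith
  have hE : ∀ c s : ℝ, HasDerivAt (fun s => exp (-(c - s))) (exp (-(c - s))) s := fun c s => by
    have : HasDerivAt (fun s => -(c - s)) 1 s := by
      simpa only [neg_sub] using (hasDerivAt_id' s).sub_const c
    simpa using this.exp
  have hE' : ∀ s : ℝ, HasDerivAt (fun s => exp (-s)) (-exp (-s)) s := fun s => by
    simpa using (hasDerivAt_neg s).exp
  have hr : ∀ (f f' : ℝ → ℝ), (∀ s, HasDerivAt f (f' s) s) → ∀ s,
      HasDerivAt (fun s => f (L - s)) (-f' (L - s)) s := fun f f' h s =>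
    (h (L - s)).comp_const_sub L s
  have hψ : Continuous fun s => bandKernel s + bandKernel (L - s) :=
    continuous_bandKernel.add (continuous_bandKernel.comp (by fun_prop))
  have hχ : Continuous fun s => exp (-s) + exp (-(L - s)) := by fun_prop
  -- `F''` is tested against the symmetrized potential minus its concave minorant
  have key := hF.integral_mul_deriv2_nonpos hL0 hF0 hB hint
    (φ := fun s => bandPotential s + bandPotential (L - s) - bandPotential L -
      1 / 10 * ((1 - exp (-s)) + (1 - exp (-(L - s))) - (1 - exp (-L))))
    (φ' := fun s => bandPotentialDeriv s + -bandPotentialDeriv (L - s) -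
      1 / 10 * (exp (-s) - exp (-(L - s))))
    (φ'' := fun s => (bandKernel s + bandKernel (L - s)) + 1 / 10 * (exp (-s) + exp (-(L - s))))
    (fun s => by
      refine (((hasDerivAt_bandPotential s).add (hr _ _ hasDerivAt_bandPotential s)).sub_const
        (bandPotential L)).sub (((((hE' s).const_sub 1).add ((hE L s).const_sub 1)).sub_const
          (1 - exp (-L))).const_mul (1 / 10)) |>.congr_deriv ?_
      ring)
    (fun s => by
      refine ((hasDerivAt_bandPotentialDeriv s).add
        (hr _ _ hasDerivAt_bandPotentialDeriv s).neg).sub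
          (((hE' s).sub (hE L s)).const_mul (1 / 10)) |>.congr_deriv ?_
      ring)
    (hψ.add (hχ.const_mul _)) (by simp [bandPotential_zero]) (by simp [bandPotential_zero])
    (fun s hs => by linarith [le_bandPotential_add_reflect hL hs])
  simp only [mul_add (F _) (bandKernel _ + _)] at key
  rw [intervalIntegral.integral_add (hint.mul_continuousOn hψ.continuousOn)
    (hint.mul_continuousOn (hχ.const_mul _).continuousOn)] at key
  have h01 : IntervalIntegrable F volume 0 1 := hint.mono_set (by
    rw [uIcc_of_le zero_le_one, uIcc_of_le hL0.le]; exact Icc_subset_Icc le_rfl (by linarith))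
  have h1L : IntervalIntegrable F volume 1 L := hint.mono_set (by
    rw [uIcc_of_le (by linarith), uIcc_of_le hL0.le]; exact Icc_subset_Icc (by norm_num) le_rfl)
  have hlow : 1 / 60 * F 1 ≤
      ∫ s in (0 : ℝ)..L, F s * (1 / 10 * (exp (-s) + exp (-(L - s)))) := by
    rw [← intervalIntegral.integral_add_adjacent_intervals
      (h01.mul_continuousOn (hχ.const_mul _).continuousOn)
      (h1L.mul_continuousOn (hχ.const_mul _).continuousOn)]
    have hr : 0 ≤ ∫ s in (1 : ℝ)..L, F s * (1 / 10 * (exp (-s) + exp (-(L - s)))) :=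
      intervalIntegral.integral_nonneg (by linarith) fun s hs =>
        mul_nonneg (hF0 s ⟨by linarith [hs.1], hs.2⟩) (by positivity)
    have hl : ∫ s in (0 : ℝ)..1, s * (1 / 30 * F 1) ≤
        ∫ s in (0 : ℝ)..1, F s * (1 / 10 * (exp (-s) + exp (-(L - s)))) := by
      refine intervalIntegral.integral_mono_on zero_le_one
        ((by fun_prop : Continuous fun s => s * (1 / 30 * F 1)).intervalIntegrable _ _)
        (h01.mul_continuousOn (hχ.const_mul _).continuousOn) fun s hs => ?_
      have hF1 := hF0 1 ⟨zero_le_one, by linarith⟩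
      have hFs : s * F 1 ≤ F s := by
        have := hF.2 (show (0 : ℝ) ∈ Icc 0 L from ⟨le_rfl, hL0.le⟩)
          (show (1 : ℝ) ∈ Icc 0 L from ⟨zero_le_one, by linarith⟩)
          (show 0 ≤ 1 - s by linarith [hs.2]) hs.1 (by ring)
        simp only [smul_eq_mul, mul_zero, mul_one, zero_add] at this
        have h0 := mul_nonneg (show 0 ≤ 1 - s by linarith [hs.2]) (hF0 0 ⟨le_rfl, hL0.le⟩)
        linarith
      have he : 1 / 3 ≤ exp (-s) := by
        have h1 : exp (-1) ≤ exp (-s) := exp_le_exp.2 (by linarith [hs.2])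
        have h2 : 1 / 3 ≤ exp (-1) := by
          rw [exp_neg, one_div]
          exact inv_anti₀ (exp_pos 1) (by linarith [exp_one_lt_d9])
        linarith
      calc s * (1 / 30 * F 1) = s * F 1 * (1 / 10 * (1 / 3 + 0)) := by ring
        _ ≤ F s * (1 / 10 * (exp (-s) + exp (-(L - s)))) := by
          have := hF0 s ⟨hs.1, by linarith [hs.2]⟩
          have := exp_pos (-(L - s))
          have h4 := mul_nonneg hs.1 hF1
          gcongr
    rw [intervalIntegral.integral_mul_const, integral_id] at hl
    linarith
  linarith

/-! ### Sections of planar convex sets and the Fourier transform -/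

open MeasureTheory Set in
/-- The length of the vertical section of a planar set over the abscissa `s`. -/
noncomputable def sectionLength (K : Set (ℝ × ℝ)) (s : ℝ) : ℝ :=
  volume.real (Prod.mk s ⁻¹' K)

open MeasureTheory Set in
theorem isCompact_section {K : Set (ℝ × ℝ)} (hK : IsCompact K) (s : ℝ) :
    IsCompact (Prod.mk s ⁻¹' K) := by
  have hcl : IsClosed (Prod.mk s ⁻¹' K) := hK.isClosed.preimage (by fun_prop)
  refine (hK.image continuous_snd).of_isClosed_subset hcl fun y hy => ⟨(s, y), hy, rfl⟩

open MeasureTheory Set in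
theorem convex_section {K : Set (ℝ × ℝ)} (hK : Convex ℝ K) (s : ℝ) :
    Convex ℝ (Prod.mk s ⁻¹' K) := by
  intro y hy z hz α β hα hβ hαβ
  have := hK hy hz hα hβ hαβ
  simpa [Prod.smul_mk, ← add_mul, hαβ] using this

open MeasureTheory Set in
theorem sub_le_sectionLength {K : Set (ℝ × ℝ)} (hK : IsCompact K) (hconv : Convex ℝ K)
    {s y z : ℝ} (hy : (s, y) ∈ K) (hz : (s, z) ∈ K) : |z - y| ≤ sectionLength K s := by
  wlog h : y ≤ z generalizing y z
  · rw [abs_sub_comm]; exact this hz hy (le_of_not_ge h)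
  have h1 : Icc y z ⊆ Prod.mk s ⁻¹' K := (convex_section hconv s).ordConnected.out hy hz
  have h2 := measureReal_mono h1 (isCompact_section hK s).measure_lt_top.ne (μ := volume)
  rw [Real.volume_real_Icc_of_le h] at h2
  rwa [abs_of_nonneg (by linarith)]

open MeasureTheory Set in
/-- The one-dimensional Brunn–Minkowski inequality: sections of a planar convex set have concave
length. -/
theorem concaveOn_sectionLength {K : Set (ℝ × ℝ)} (hK : IsCompact K) (hconv : Convex ℝ K)
    {a b : ℝ} (ha : ∃ p ∈ K, p.1 = a) (hb : ∃ p ∈ K, p.1 = b) :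
    ConcaveOn ℝ (Icc a b) (sectionLength K) := by
  have hne : ∀ s ∈ Icc a b, (Prod.mk s ⁻¹' K).Nonempty := fun s hs => by
    have hconv' : (Prod.fst '' K).OrdConnected :=
      (hconv.is_linear_image (IsLinearMap.mk (by simp) (by simp))).ordConnected
    obtain ⟨p, hp, rfl⟩ := hconv'.out (x := a) (y := b)
      (by obtain ⟨p, hp, h⟩ := ha; exact ⟨p, hp, h⟩)
      (by obtain ⟨p, hp, h⟩ := hb; exact ⟨p, hp, h⟩) hs
    exact ⟨p.2, hp⟩
  have hsec : ∀ s ∈ Icc a b, ∃ l u, (s, l) ∈ K ∧ (s, u) ∈ K ∧ sectionLength K s = u - l := by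
    intro s hs
    have h := eq_Icc_of_connected_compact ⟨hne s hs, (convex_section hconv s).isPreconnected⟩
      (isCompact_section hK s)
    have hle : sInf (Prod.mk s ⁻¹' K) ≤ sSup (Prod.mk s ⁻¹' K) := by
      have := hne s hs
      rw [h] at this
      exact nonempty_Icc.1 this
    refine ⟨_, _, (isCompact_section hK s).sInf_mem (hne s hs),
      (isCompact_section hK s).sSup_mem (hne s hs), ?_⟩
    rw [sectionLength, h, Real.volume_real_Icc_of_le hle, ← h]
  refine ⟨convex_Icc _ _, fun s hs t ht α β hα hβ hαβ => ?_⟩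
  obtain ⟨l, u, hl, hu, h⟩ := hsec s hs
  obtain ⟨l', u', hl', hu', h'⟩ := hsec t ht
  have h1 := hconv hl hl' hα hβ hαβ
  have h2 := hconv hu hu' hα hβ hαβ
  simp only [Prod.smul_mk, Prod.mk_add_mk] at h1 h2
  have h3 := (le_abs_self _).trans (sub_le_sectionLength hK hconv h1 h2)
  simp only [smul_eq_mul] at h3 ⊢
  rw [h, h']
  linarith

open MeasureTheory Set in
/-- Fubini's theorem for functions of the first coordinate. -/
theorem setIntegral_comp_fst {K : Set (ℝ × ℝ)} (hK : IsCompact K) {a b : ℝ} (hab : a ≤ b)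
    (hKab : ∀ p ∈ K, p.1 ∈ Icc a b) {g : ℝ → ℝ} (hg : Continuous g) :
    ∫ p in K, g p.1 = ∫ s in a..b, sectionLength K s * g s := by
  have hm : MeasurableSet K := hK.measurableSet
  have hint : IntegrableOn (fun p : ℝ × ℝ => g p.1) K volume :=
    (hg.comp continuous_fst).continuousOn.integrableOn_compact hK
  rw [← integral_indicator hm, Measure.volume_eq_prod,
    integral_prod _ (by rw [← Measure.volume_eq_prod]; exact hint.integrable_indicator hm),
    intervalIntegral.integral_of_le hab, ← integral_Icc_eq_integral_Ioc,
    ← integral_indicator measurableSet_Icc]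
  congr 1
  ext s
  have h1 : ∀ y, K.indicator (fun p : ℝ × ℝ => g p.1) (s, y) =
      (Prod.mk s ⁻¹' K).indicator (fun _ => g s) y := fun y => by
    by_cases h : (s, y) ∈ K <;> simp [h]
  simp only [h1]
  rw [integral_indicator (isCompact_section hK s).measurableSet, setIntegral_const, smul_eq_mul]
  by_cases hs : s ∈ Icc a b
  · rw [indicator_of_mem hs, sectionLength]
  · have : Prod.mk s ⁻¹' K = ∅ := by
      ext y
      simp only [mem_preimage, mem_empty_iff_false, iff_false]
      exact fun hy => hs (hKab _ hy)
    rw [indicator_of_notMem hs, this]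
    simp

open MeasureTheory Set in
theorem integrable_sectionLength {K : Set (ℝ × ℝ)} (hK : IsCompact K) :
    Integrable (sectionLength K) :=
  Measure.integrable_measure_prodMk_left (μ := (volume : Measure ℝ)) (ν := (volume : Measure ℝ))
    hK.measurableSet (by rw [← Measure.volume_eq_prod]; exact hK.measure_lt_top.ne)

open MeasureTheory Set in
theorem sectionLength_bdd {K : Set (ℝ × ℝ)} (hK : IsCompact K) :
    ∃ B, ∀ s, sectionLength K s ≤ B := by
  have hc := hK.image continuous_snd
  refine ⟨volume.real (Prod.snd '' K), fun s => ?_⟩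
  exact measureReal_mono (fun y hy => ⟨(s, y), hy, rfl⟩) hc.measure_lt_top.ne

open MeasureTheory Set in
/-- The Cauchy–Schwarz inequality on an interval of length `1/2`. -/
theorem sq_integral_band_le {g : ℝ → ℝ} (hg : Continuous g) :
    2 * (∫ τ in (1 / 2 : ℝ)..1, g τ) ^ 2 ≤ ∫ τ in (1 / 2 : ℝ)..1, g τ ^ 2 := by
  set m := ∫ τ in (1 / 2 : ℝ)..1, g τ with hm
  have h : 0 ≤ ∫ τ in (1 / 2 : ℝ)..1, (g τ - 2 * m) ^ 2 :=
    intervalIntegral.integral_nonneg (by norm_num) fun τ _ => sq_nonneg _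
  have h2 : ∀ τ, (g τ - 2 * m) ^ 2 = g τ ^ 2 - 4 * m * g τ + 4 * m ^ 2 := fun τ => by ring
  simp only [h2] at h
  rw [intervalIntegral.integral_add, intervalIntegral.integral_sub,
    intervalIntegral.integral_const_mul, ← hm, intervalIntegral.integral_const, smul_eq_mul] at h
  · linarith
  all_goals exact (by fun_prop : Continuous _).intervalIntegrable _ _

open MeasureTheory Set Complex in
/-- Lower bound for the Fourier transform of a planar convex body in the first coordinate
direction, averaged over dilations by factors in `[1/2, 1]`, in terms of the length of one section
at distance `1 / R` from the boundary. The constant `2520 = 42 * 60` combines the bound for the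
weight with the constant of `ConcaveOn.integral_mul_bandKernel_le`. -/
theorem sq_sectionLength_le_integral_fourier {K : Set (ℝ × ℝ)} (hK : IsCompact K)
    (hconv : Convex ℝ K) {a b R : ℝ} (hKab : ∀ p ∈ K, p.1 ∈ Icc a b)
    (ha : ∃ p ∈ K, p.1 = a) (hb : ∃ p ∈ K, p.1 = b) (hR : 0 < R) (hL : 10000 ≤ R * (b - a)) :
    2 * (sectionLength K (a + 1 / R) / (2520 * R)) ^ 2 ≤
      ∫ τ in (1 / 2 : ℝ)..1, ‖∫ p in K, exp (-(R * τ * p.1 : ℝ) * I)‖ ^ 2 := by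
  set L := R * (b - a) with hLdef
  have hab : a ≤ b := by
    by_contra! h
    have : R * (b - a) < 0 := mul_neg_of_pos_of_neg hR (by linarith)
    linarith
  set J : ℝ → ℂ := fun τ => ∫ p in K, exp (-(R * τ * p.1 : ℝ) * I) with hJ
  have hJc : Continuous J :=
    continuous_parametric_integral_of_continuous
      (f := fun (τ : ℝ) (p : ℝ × ℝ) => exp (-(R * τ * p.1 : ℝ) * I)) (by fun_prop) hK
  -- the weight turning `J` into the integral of the band-limited kernel over `K`
  set W : ℝ → ℂ := fun τ => (τ : ℂ) ^ 2 * (exp ((τ * (R * a) : ℝ) * I) *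
    ((20 - I) + (20 + I) * exp ((τ * L : ℝ) * I))) with hW
  have hWc : Continuous W := by fun_prop
  have hWn : ∀ τ ∈ Icc (1 / 2 : ℝ) 1, ‖W τ‖ ≤ 42 := fun τ hτ => by
    have e1 : ‖(20 - I : ℂ)‖ ≤ 21 := (norm_sub_le _ _).trans (by norm_num)
    have e2 : ‖(20 + I : ℂ)‖ ≤ 21 := (norm_add_le _ _).trans (by norm_num)
    have e3 : ‖(20 - I) + (20 + I) * exp ((τ * L : ℝ) * I)‖ ≤ 42 := by
      refine (norm_add_le _ _).trans ?_
      rw [norm_mul, norm_exp_ofReal_mul_I, mul_one]; linarith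
    have e4 : ‖(τ : ℂ) ^ 2‖ ≤ 1 := by
      rw [norm_pow, norm_real, Real.norm_eq_abs, sq_abs]
      nlinarith [hτ.1, hτ.2]
    simp only [hW]
    rw [norm_mul, norm_mul, norm_exp_ofReal_mul_I, one_mul]
    calc _ ≤ 1 * (42 : ℝ) := by gcongr
      _ = 42 := one_mul _
  set κ : ℝ → ℝ → ℝ := fun τ u => τ ^ 2 * (20 * Real.cos (τ * u) - Real.sin (τ * u)) with hκ
  have hre : ∀ τ : ℝ, (W τ * J τ).re = ∫ p in K, (κ τ (R * (p.1 - a)) + κ τ (L - R * (p.1 - a))) := by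
    intro τ
    have hi : IntegrableOn (fun p : ℝ × ℝ => W τ * exp (-(R * τ * p.1 : ℝ) * I)) K volume :=
      (by fun_prop : Continuous fun p : ℝ × ℝ => W τ * exp (-(R * τ * p.1 : ℝ) * I))
        |>.continuousOn.integrableOn_compact hK
    simp only [hJ]
    rw [← integral_const_mul, ← RCLike.re_eq_complex_re, ← integral_re hi]
    refine integral_congr_ae (Filter.Eventually.of_forall fun p => ?_)
    simp only [hW, hκ, RCLike.re_eq_complex_re]
    have e1 : (τ : ℂ) ^ 2 * (exp ((τ * (R * a) : ℝ) * I) *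
        ((20 - I) + (20 + I) * exp ((τ * L : ℝ) * I))) * exp (-(R * τ * p.1 : ℝ) * I) =
        ((τ ^ 2 : ℝ) : ℂ) * ((20 - I) * exp ((-(τ * (R * (p.1 - a))) : ℝ) * I) +
          (20 + I) * exp ((τ * (L - R * (p.1 - a)) : ℝ) * I)) := by
      have : ∀ x y z : ℝ, exp (x * I) * ((20 - I) + (20 + I) * exp (y * I)) * exp (-(z : ℝ) * I) =
          (20 - I) * exp ((x - z : ℝ) * I) + (20 + I) * exp ((x + y - z : ℝ) * I) := by
        intro x y z
        rw [show ((x - z : ℝ) : ℂ) * I = x * I + -z * I by push_cast; ring,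
          show ((x + y - z : ℝ) : ℂ) * I = x * I + y * I + -z * I by push_cast; ring]
        simp only [exp_add]; ring
      rw [mul_assoc, this]
      rw [show τ * (R * a) - R * τ * p.1 = -(τ * (R * (p.1 - a))) by ring,
        show τ * (R * a) + τ * L - R * τ * p.1 = τ * (L - R * (p.1 - a)) by ring]
      push_cast
      ring
    rw [e1, re_ofReal_mul, exp_ofReal_mul_I, exp_ofReal_mul_I]
    have e2 : ∀ x y : ℝ, ((20 - I) * (Real.cos x + Real.sin x * I) +
        (20 + I) * (Real.cos y + Real.sin y * I)).re =
        20 * Real.cos x + Real.sin x + (20 * Real.cos y - Real.sin y) := fun x y => by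
      simp [-ofReal_cos, -ofReal_sin]
    rw [e2, Real.cos_neg, Real.sin_neg]
    ring
  have hswap : ∫ τ in (1 / 2 : ℝ)..1, (W τ * J τ).re =
      ∫ p in K, (bandKernel (R * (p.1 - a)) + bandKernel (L - R * (p.1 - a))) := by
    simp only [hre]
    rw [intervalIntegral_integral_swap]
    · congr 1
      ext p
      rw [intervalIntegral.integral_add]
      · rfl
      all_goals
        simp only [hκ]
        exact (by fun_prop : Continuous _).intervalIntegrable _ _
    · have : IntegrableOn (Function.uncurry fun (τ : ℝ) (p : ℝ × ℝ) =>
          κ τ (R * (p.1 - a)) + κ τ (L - R * (p.1 - a))) (Icc (1 / 2 : ℝ) 1 ×ˢ K)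
          (volume.prod volume) := by
        refine ContinuousOn.integrableOn_compact (isCompact_Icc.prod hK) ?_
        simp only [hκ, Function.uncurry_def]
        fun_prop
      rw [IntegrableOn, ← Measure.prod_restrict] at this
      refine this.mono_measure (Measure.prod_mono ?_ le_rfl)
      exact Measure.restrict_mono (by rw [uIoc_of_le (by norm_num)]; exact Ioc_subset_Icc_self) le_rfl
  rw [setIntegral_comp_fst hK hab hKab (g := fun s => bandKernel (R * (s - a)) +
    bandKernel (L - R * (s - a))) (by have := continuous_bandKernel; fun_prop)] at hswap
  -- rescale so that the sections are parametrized by `[0, L]`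
  have hscale : ∫ s in a..b, sectionLength K s * (bandKernel (R * (s - a)) +
      bandKernel (L - R * (s - a))) = 1 / R * ∫ u in (0 : ℝ)..L, sectionLength K (a + 1 / R * u) *
        (bandKernel u + bandKernel (L - u)) := by
    have := intervalIntegral.integral_comp_mul_sub (a := a) (b := b) (fun u =>
      sectionLength K (a + 1 / R * u) * (bandKernel u + bandKernel (L - u))) hR.ne' (R * a)
    rw [show R * a - R * a = 0 by ring, show R * b - R * a = L by rw [hLdef]; ring, smul_eq_mul,
      ← one_div] at this
    rw [← this]
    congr 1
    ext s
    rw [show R * s - R * a = R * (s - a) by ring,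
      show a + 1 / R * (R * (s - a)) = s by field_simp; ring]
  obtain ⟨B, hB⟩ := sectionLength_bdd hK
  have hmaps : ∀ u ∈ Icc 0 L, a + 1 / R * u ∈ Icc a b := fun u hu => by
    have h1 : 0 ≤ 1 / R * u := mul_nonneg (by positivity) hu.1
    have h2 : 1 / R * u ≤ 1 / R * L := by gcongr; exact hu.2
    have h3 : 1 / R * L = b - a := by rw [hLdef]; field_simp
    exact ⟨by linarith, by linarith⟩
  have hconc : ConcaveOn ℝ (Icc 0 L) fun u => sectionLength K (a + 1 / R * u) := by
    refine ⟨convex_Icc _ _, fun u hu v hv α β hα hβ hαβ => ?_⟩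
    have := (concaveOn_sectionLength hK hconv ha hb).2 (hmaps u hu) (hmaps v hv) hα hβ hαβ
    refine this.trans (le_of_eq ?_)
    congr 1
    simp only [smul_eq_mul]
    linear_combination a * hαβ
  have hint : IntervalIntegrable (fun u => sectionLength K (a + 1 / R * u)) volume 0 L :=
    (((integrable_sectionLength hK).comp_add_left a).comp_mul_left'
      (R := 1 / R) (by positivity)).intervalIntegrable
  have hmain := hconc.integral_mul_bandKernel_le hL (fun u _ => measureReal_nonneg)
    (fun u _ => hB _) hint
  rw [hscale] at hswap
  have hnorm : |∫ τ in (1 / 2 : ℝ)..1, (W τ * J τ).re| ≤ 42 * ∫ τ in (1 / 2 : ℝ)..1, ‖J τ‖ := by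
    rw [← intervalIntegral.integral_const_mul]
    refine (intervalIntegral.abs_integral_le_integral_abs (by norm_num)).trans ?_
    refine intervalIntegral.integral_mono_on (by norm_num)
      ((by fun_prop : Continuous fun τ => |(W τ * J τ).re|).intervalIntegrable _ _)
      ((by fun_prop : Continuous fun τ => 42 * ‖J τ‖).intervalIntegrable _ _) fun τ hτ => ?_
    refine (abs_re_le_norm _).trans ?_
    rw [norm_mul]
    gcongr
    exact hWn τ hτ
  refine le_trans ?_ (sq_integral_band_le hJc.norm)
  rw [mul_one] at hmain
  have h0 : 0 ≤ sectionLength K (a + 1 / R) := measureReal_nonneg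
  have hfin : sectionLength K (a + 1 / R) / (2520 * R) ≤ ∫ τ in (1 / 2 : ℝ)..1, ‖J τ‖ := by
    rw [hswap] at hnorm
    have h1 := (neg_le_abs _).trans hnorm
    have h2 := mul_le_mul_of_nonneg_left hmain (show 0 ≤ 1 / R by positivity)
    have h3 : sectionLength K (a + 1 / R) / (2520 * R) =
      1 / 42 * (1 / R * (1 / 60 * sectionLength K (a + 1 / R))) := by
      ring
    rw [h3]
    linarith
  gcongr

/-! ### Boundary points with bounded curvature -/

open Set in
/-- First-order Taylor expansion with quadratic remainder, for a Lipschitz derivative. -/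
theorem norm_taylor_le_of_lipschitz_deriv {E : Type*} [NormedAddCommGroup E] [NormedSpace ℝ E]
    {f f' : ℝ → E} {J : Set ℝ} (hJ : J.OrdConnected) {K : ℝ} (hK : 0 ≤ K)
    (hf : ∀ x ∈ J, HasDerivAt f (f' x) x) (hL : ∀ x ∈ J, ∀ y ∈ J, ‖f' y - f' x‖ ≤ K * |y - x|)
    {x y : ℝ} (hx : x ∈ J) (hy : y ∈ J) :
    ‖f y - f x - (y - x) • f' x‖ ≤ K * (y - x) ^ 2 := by
  have hsub : uIcc x y ⊆ J := hJ.uIcc_subset hx hy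
  have := Convex.norm_image_sub_le_of_norm_hasDerivWithin_le (s := uIcc x y)
    (f := fun z => f z - z • f' x) (f' := fun z => f' z - f' x) (C := K * |y - x|)
    (fun z hz => by
      have h1 : HasDerivAt (fun z : ℝ => z • f' x) (f' x) z := by
        simpa using (hasDerivAt_id z).smul_const (f' x)
      exact ((hf z (hsub hz)).sub h1).hasDerivWithinAt)
    (fun z hz => (hL x hx z (hsub hz)).trans (
      mul_le_mul_of_nonneg_left (abs_sub_left_of_mem_uIcc hz) hK)) (convex_uIcc x y) left_mem_uIcc right_mem_uIcc
  rw [Real.norm_eq_abs, mul_assoc, ← sq, sq_abs] at this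
  convert this using 2
  module

/-- Near `p`, the set `C` contains points quadratically close to both directions of a line through
`p`: the set is not pinched at `p`. For a boundary point of a convex set this says that the
curvature is bounded above. -/
def TwoSidedTangent (C : Set Plane) (M δ : ℝ) (p : Plane) : Prop :=
  ∃ e : Plane, 1 ≤ ‖e‖ ∧ ∀ s : ℝ, |s| ≤ δ → ∃ q ∈ C, ‖q - p - s • e‖ ≤ M * s ^ 2

theorem TwoSidedTangent.mono {C : Set Plane} {M M' δ δ' : ℝ} {p : Plane}
    (h : TwoSidedTangent C M δ p) (hM : M ≤ M') (hδ : δ' ≤ δ) : TwoSidedTangent C M' δ' p := by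
  obtain ⟨e, he, h⟩ := h
  refine ⟨e, he, fun s hs => ?_⟩
  obtain ⟨q, hq, hqe⟩ := h s (hs.trans hδ)
  exact ⟨q, hq, hqe.trans (by gcongr)⟩

open Set in
/-- The boundary of a planar convex body is locally a graph: near a boundary point `p`, a linear
functional vanishing on the direction to an interior point is injective on the boundary. -/
theorem Convex.exists_injOn_frontier {C : Set Plane} (hC : Convex ℝ C) (hcl : IsClosed C)
    {z p : Plane} (hz : z ∈ interior C) (hp : p ∈ frontier C) :
    ∃ ρ > 0, ∃ l : Plane → ℝ, Continuous l ∧ InjOn l (frontier C ∩ Metric.ball p ρ) := by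
  obtain ⟨ρ₀, hρ₀, hball⟩ := Metric.isOpen_iff.1 isOpen_interior z hz
  have hzp : z - p ≠ 0 := fun h => hp.2 (by rwa [← sub_eq_zero.1 h])
  have hn : 0 < ‖z - p‖ := norm_pos_iff.2 hzp
  refine ⟨min ρ₀ (‖z - p‖ / 2), lt_min hρ₀ (by positivity),
    fun x => (z - p) 0 * x 1 - (z - p) 1 * x 0, by fun_prop, ?_⟩
  -- two distinct points with equal values differ by a small multiple of `z - p`
  have hdir : ∀ x : Plane, (z - p) 0 * x 1 - (z - p) 1 * x 0 = 0 → ∃ t : ℝ, x = t • (z - p) := by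
    intro x hx
    by_cases h0 : (z - p) 0 = 0
    · have h1 : (z - p) 1 ≠ 0 := fun h1 => hzp (by ext i; fin_cases i <;> assumption)
      refine ⟨x 1 / (z - p) 1, ?_⟩
      have hx0 : x 0 = 0 := by
        rw [h0, zero_mul, zero_sub, neg_eq_zero] at hx
        exact (mul_eq_zero.1 hx).resolve_left h1
      ext i
      fin_cases i
      · simp only [Fin.zero_eta, PiLp.smul_apply, h0, hx0, smul_zero]
      · simp only [Fin.mk_one, PiLp.smul_apply, smul_eq_mul]; field_simp
    · refine ⟨x 0 / (z - p) 0, ?_⟩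
      ext i
      fin_cases i
      · simp only [Fin.zero_eta, PiLp.smul_apply, smul_eq_mul]; field_simp
      · simp only [Fin.mk_one, PiLp.smul_apply, smul_eq_mul]; field_simp; linarith
  have main : ∀ x ∈ frontier C ∩ Metric.ball p (min ρ₀ (‖z - p‖ / 2)),
      ∀ y ∈ frontier C ∩ Metric.ball p (min ρ₀ (‖z - p‖ / 2)), ∀ t : ℝ,
      y - x = t • (z - p) → ¬ 0 < t := by
    intro x hx y hy t ht h0
    have hx' := Metric.mem_ball.1 hx.2
    have hy' := Metric.mem_ball.1 hy.2
    have ht1 : t < 1 := by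
      have h1 : ‖y - x‖ < ‖z - p‖ := by
        rw [← dist_eq_norm]
        have := dist_triangle_right y x p
        have := min_le_right ρ₀ (‖z - p‖ / 2)
        linarith
      rw [ht, norm_smul, Real.norm_eq_abs, abs_of_pos h0] at h1
      by_contra! h
      nlinarith
    have hxC : x ∈ C := hcl.frontier_subset hx.1
    have hi : x + (z - p) ∈ interior C := hball (by
      rw [Metric.mem_ball, dist_eq_norm, show x + (z - p) - z = x - p by abel, ← dist_eq_norm]
      exact hx'.trans_le (min_le_left _ _))
    refine hy.1.2 (hC.openSegment_self_interior_subset_interior hxC hi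
      ⟨1 - t, t, by linarith, h0, by ring, ?_⟩)
    rw [smul_add, ← ht]
    module
  intro x hx y hy hxy
  simp only at hxy
  obtain ⟨t, ht⟩ := hdir (y - x) (by simp only [PiLp.sub_apply] at hxy ⊢; linarith)
  rcases lt_trichotomy t 0 with h | h | h
  · exact absurd (by linarith : 0 < -t) (main y hy x hx (-t) (by
      rw [neg_smul, ← ht]; abel))
  · rw [h, zero_smul] at ht
    exact (sub_eq_zero.1 ht).symm
  · exact absurd h (main x hx y hy t ht)

open Set Filter Topology in
/-- At a smooth boundary point of a convex body, `TwoSidedTangent` holds uniformly nearby. The arc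
given by the smoothness assumption covers all boundary points near `p`, because in a graph
coordinate it is injective and hence monotone. -/
theorem SmoothWithCurvatureGE.twoSidedTangent {C : Set Plane} (hC : Convex ℝ C)
    (hcl : IsClosed C) {z p : Plane} (hz : z ∈ interior C) (hp : p ∈ frontier C) {κ : ℝ}
    (h : SmoothWithCurvatureGE (frontier C) p κ) :
    ∃ M δ : ℝ, 0 < M ∧ 0 < δ ∧ ∀ᶠ x in 𝓝[frontier C] p, TwoSidedTangent C M δ x := by
  obtain ⟨Γ, ε, V, hε, -, -, h0, hsm, hinj, hunit, himg, -⟩ := h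
  obtain ⟨ρ, hρ, l, hl, hlinj⟩ := hC.exists_injOn_frontier hcl hz hp
  have hΓfr : ∀ s ∈ Ioo (-ε) ε, Γ s ∈ frontier C := fun s hs =>
    (himg.superset (mem_image_of_mem Γ hs)).1
  have hmem0 : (0 : ℝ) ∈ Ioo (-ε) ε := ⟨by linarith, hε⟩
  have hdiff : DifferentiableOn ℝ Γ (Ioo (-ε) ε) ∧ ContDiffOn ℝ ∞ (deriv Γ) (Ioo (-ε) ε) :=
    (contDiffOn_infty_iff_deriv_of_isOpen isOpen_Ioo).1 hsm
  have hdiff2 : DifferentiableOn ℝ (deriv Γ) (Ioo (-ε) ε) ∧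
      ContDiffOn ℝ ∞ (deriv (deriv Γ)) (Ioo (-ε) ε) :=
    (contDiffOn_infty_iff_deriv_of_isOpen isOpen_Ioo).1 hdiff.2
  obtain ⟨η₀, hη₀, hη₀b⟩ : ∃ η₀ > 0, ∀ s, |s| < η₀ → Γ s ∈ Metric.ball p ρ := by
    have hc : ContinuousAt Γ 0 := (hsm.continuousOn).continuousAt (Ioo_mem_nhds hmem0.1 hmem0.2)
    have := hc.eventually (Metric.ball_mem_nhds (Γ 0) hρ)
    rw [h0] at this
    obtain ⟨η₀, hη₀, hb⟩ := Metric.eventually_nhds_iff.1 this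
    exact ⟨η₀, hη₀, fun s hs => hb (by simpa using hs)⟩
  set η := min (η₀ / 2) (ε / 3) with hη
  have hηpos : 0 < η := lt_min (by positivity) (by positivity)
  have hη1 : η < η₀ := (min_le_left _ _).trans_lt (by linarith)
  have hη2 : η ≤ ε / 3 := min_le_right _ _
  have hsub2 : Icc (-(2 * η)) (2 * η) ⊆ Ioo (-ε) ε := fun s hs =>
    ⟨by linarith [hs.1], by linarith [hs.2]⟩
  have hsub1 : Icc (-η) η ⊆ Ioo (-ε) ε := fun s hs => ⟨by linarith [hs.1], by linarith [hs.2]⟩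
  obtain ⟨K, hK⟩ := (isCompact_Icc (a := -(2 * η)) (b := 2 * η)).exists_bound_of_continuousOn
    (hdiff2.2.continuousOn.mono hsub2)
  have hK' : ∀ s ∈ Icc (-(2 * η)) (2 * η), ‖deriv (deriv Γ) s‖ ≤ max K 1 := fun s hs =>
    (hK s hs).trans (le_max_left _ _)
  have hder : ∀ s ∈ Icc (-(2 * η)) (2 * η), HasDerivAt Γ (deriv Γ s) s := fun s hs =>
    ((hdiff.1 s (hsub2 hs)).differentiableAt (isOpen_Ioo.mem_nhds (hsub2 hs))).hasDerivAt
  have hder2 : ∀ s ∈ Icc (-(2 * η)) (2 * η), DifferentiableAt ℝ (deriv Γ) s := fun s hs =>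
    (hdiff2.1 s (hsub2 hs)).differentiableAt (isOpen_Ioo.mem_nhds (hsub2 hs))
  have hmaps : ∀ s ∈ Icc (-η) η, Γ s ∈ frontier C ∩ Metric.ball p ρ := fun s hs =>
    ⟨hΓfr s (hsub1 hs), hη₀b s ((abs_le.2 hs).trans_lt hη1)⟩
  have hxinj : InjOn (fun s => l (Γ s)) (Icc (-η) η) := fun s hs t ht hst =>
    hinj (hsub1 hs) (hsub1 ht) (hlinj (hmaps s hs) (hmaps t ht) hst)
  have hxc : ContinuousOn (fun s => l (Γ s)) (Icc (-η) η) :=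
    hl.comp_continuousOn (hsm.continuousOn.mono hsub1)
  have hcover : ∀ᶠ y in 𝓝 (l p), y ∈ (fun s => l (Γ s)) '' Icc (-η) η := by
    have m1 : -η ∈ Icc (-η) η := ⟨le_rfl, by linarith⟩
    have m2 : η ∈ Icc (-η) η := ⟨by linarith, le_rfl⟩
    have m0 : (0 : ℝ) ∈ Icc (-η) η := ⟨by linarith, hηpos.le⟩
    rw [← h0]
    rcases hxc.strictMonoOn_of_injOn_Icc' (by linarith) hxinj with hm | hm
    · filter_upwards [Icc_mem_nhds (hm m1 m0 (by linarith)) (hm m0 m2 hηpos)] with y hy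
      exact intermediate_value_Icc (by linarith) hxc hy
    · filter_upwards [Icc_mem_nhds (hm m0 m2 hηpos) (hm m1 m0 (by linarith))] with y hy
      exact intermediate_value_Icc' (by linarith) hxc hy
  refine ⟨max K 1, η, by positivity, hηpos, ?_⟩
  have e1 : ∀ᶠ x in 𝓝[frontier C] p, l x ∈ (fun s => l (Γ s)) '' Icc (-η) η :=
    (hl.continuousAt.eventually hcover).filter_mono nhdsWithin_le_nhds
  have e2 : ∀ᶠ x in 𝓝[frontier C] p, x ∈ Metric.ball p ρ :=
    nhdsWithin_le_nhds (Metric.ball_mem_nhds p hρ)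
  filter_upwards [e1, e2, self_mem_nhdsWithin] with x ⟨s₀, hs₀, hx⟩ hxb hxf
  obtain rfl : Γ s₀ = x := hlinj (hmaps s₀ hs₀) ⟨hxf, hxb⟩ hx
  refine ⟨deriv Γ s₀, (hunit s₀ (hsub1 hs₀)).ge, fun s hs => ?_⟩
  have hs' := abs_le.1 hs
  have hm1 : s₀ + s ∈ Icc (-(2 * η)) (2 * η) := ⟨by linarith [hs₀.1], by linarith [hs₀.2]⟩
  have hm0 : s₀ ∈ Icc (-(2 * η)) (2 * η) := ⟨by linarith [hs₀.1], by linarith [hs₀.2]⟩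
  refine ⟨Γ (s₀ + s), hcl.frontier_subset (hΓfr _ (hsub2 hm1)), ?_⟩
  have := norm_taylor_le_of_lipschitz_deriv (ordConnected_Icc (a := -(2 * η)) (b := 2 * η))
    (K := max K 1) (by positivity) hder (fun x hx y hy =>
      (convex_Icc (-(2 * η)) (2 * η)).norm_image_sub_le_of_norm_deriv_le hder2 hK' hx hy) hm0 hm1
  rwa [add_sub_cancel_left] at this

open Set in
theorem abs_rpow_sub_mul_lipschitz {γ : ℝ} (hγ : 2 < γ) {x y : ℝ} (hx : x ∈ Icc (-1 : ℝ) 1)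
    (hy : y ∈ Icc (-1 : ℝ) 1) :
    |(|y| ^ (γ - 2) * y) - |x| ^ (γ - 2) * x| ≤ (γ - 1) * |y - x| := by
  have hpow : ∀ x : ℝ, 0 ≤ x → |x| ^ (γ - 2) * x = x ^ (γ - 1) := fun x hx => by
    rw [abs_of_nonneg hx, ← Real.rpow_add_one' hx (by linarith)]; ring_nf
  have hpos : ∀ x ∈ Icc (0 : ℝ) 1, ∀ y ∈ Icc (0 : ℝ) 1,
      |(|y| ^ (γ - 2) * y) - |x| ^ (γ - 2) * x| ≤ (γ - 1) * |y - x| := by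
    intro x hx y hy
    rw [hpow x hx.1, hpow y hy.1]
    refine Convex.norm_image_sub_le_of_norm_hasDerivWithin_le (s := Icc (0 : ℝ) 1)
      (fun z _ => (Real.hasDerivAt_rpow_const (p := γ - 1) (Or.inr (by linarith))).hasDerivWithinAt)
      (fun z hz => ?_) (convex_Icc 0 1) hx hy
    rw [Real.norm_eq_abs, abs_of_nonneg (mul_nonneg (by linarith) (Real.rpow_nonneg hz.1 _))]
    exact mul_le_of_le_one_right (by linarith) (Real.rpow_le_one hz.1 hz.2 (by linarith))
  have hone : ∀ x ∈ Icc (0 : ℝ) 1, |x| ^ (γ - 2) * x ≤ (γ - 1) * x := fun x hx => by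
    have := (le_abs_self _).trans (hpos 0 ⟨le_rfl, zero_le_one⟩ x hx)
    simpa [abs_of_nonneg hx.1] using this
  rcases le_total 0 x with h0 | h0 <;> rcases le_total 0 y with h1 | h1
  · exact hpos x ⟨h0, hx.2⟩ y ⟨h1, hy.2⟩
  · have e1 := hone x ⟨h0, hx.2⟩
    have e2 := hone (-y) ⟨by linarith, by linarith [hy.1]⟩
    rw [abs_neg] at e2
    have e3 : 0 ≤ |x| ^ (γ - 2) * x := by positivity
    have e4 : 0 ≤ |y| ^ (γ - 2) * -y := mul_nonneg (by positivity) (by linarith)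
    rw [abs_of_nonpos (by linarith), abs_of_nonpos (by linarith : y - x ≤ 0)]
    linarith
  · have e1 := hone y ⟨h1, hy.2⟩
    have e2 := hone (-x) ⟨by linarith, by linarith [hx.1]⟩
    rw [abs_neg] at e2
    have e3 : 0 ≤ |y| ^ (γ - 2) * y := by positivity
    have e4 : 0 ≤ |x| ^ (γ - 2) * -x := mul_nonneg (by positivity) (by linarith)
    rw [abs_of_nonneg (by linarith), abs_of_nonneg (by linarith : 0 ≤ y - x)]
    linarith
  · have := hpos (-x) ⟨by linarith, by linarith [hx.1]⟩ (-y) ⟨by linarith, by linarith [hy.1]⟩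
    rw [abs_neg, abs_neg] at this
    rw [abs_sub_comm y x]
    convert this using 1
    · rw [← abs_neg]; congr 1; ring
    · congr 2; ring

open Set in
/-- The graph of `|x| ^ γ` has bounded curvature near the origin. -/
theorem twoSidedTangent_of_graph {γ : ℝ} (hγ : 2 < γ) {C : Set Plane} {r : ℝ}
    (hC : {p : Plane | p 1 = |p 0| ^ γ} ∩ Metric.ball 0 r ⊆ C) {p : Plane}
    (hp : p 1 = |p 0| ^ γ) (hpr : p ∈ Metric.ball (0 : Plane) (r / 2)) (hp0 : |p 0| ≤ 1 / 2) :
    TwoSidedTangent C (γ * (γ - 1)) (min (1 / 2) (r / (2 * (γ ^ 2 + 2)))) p := by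
  set x := p 0 with hx
  have hder : ∀ y ∈ Icc (-1 : ℝ) 1, HasDerivAt (fun y => |y| ^ γ) (γ * |y| ^ (γ - 2) * y) y :=
    fun y _ => hasDerivAt_abs_rpow y (by linarith)
  have hlip : ∀ y ∈ Icc (-1 : ℝ) 1, ∀ z ∈ Icc (-1 : ℝ) 1,
      ‖γ * |z| ^ (γ - 2) * z - γ * |y| ^ (γ - 2) * y‖ ≤ γ * (γ - 1) * |z - y| := by
    intro y hy z hz
    rw [Real.norm_eq_abs, mul_assoc, mul_assoc, ← mul_sub, abs_mul, abs_of_pos (by linarith),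
      mul_assoc]
    exact mul_le_mul_of_nonneg_left (abs_rpow_sub_mul_lipschitz hγ hy hz) (by linarith)
  have hxm : x ∈ Icc (-1 : ℝ) 1 := by
    have := abs_le.1 hp0
    exact ⟨by linarith, by linarith⟩
  refine ⟨!₂[1, γ * |x| ^ (γ - 2) * x], ?_, fun s hs => ?_⟩
  · have := PiLp.norm_apply_le (!₂[1, γ * |x| ^ (γ - 2) * x] : Plane) 0
    simpa using this
  have hs1 : |s| ≤ 1 / 2 := hs.trans (min_le_left _ _)
  have hs2 : |s| ≤ r / (2 * (γ ^ 2 + 2)) := hs.trans (min_le_right _ _)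
  have hxs : x + s ∈ Icc (-1 : ℝ) 1 := by
    have := abs_le.1 hp0
    have := abs_le.1 hs1
    exact ⟨by linarith, by linarith⟩
  have htay := norm_taylor_le_of_lipschitz_deriv (ordConnected_Icc (a := (-1 : ℝ)) (b := 1))
    (by nlinarith : 0 ≤ γ * (γ - 1)) hder hlip hxm hxs
  rw [add_sub_cancel_left, smul_eq_mul] at htay
  have hsq : ∀ a b : ℝ, ‖(!₂[a, b] : Plane)‖ ≤ |a| + |b| := fun a b => by
    rw [EuclideanSpace.norm_eq, Fin.sum_univ_two]
    refine Real.sqrt_le_iff.2 ⟨by positivity, ?_⟩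
    simp only [Real.norm_eq_abs, Matrix.cons_val_zero, Matrix.cons_val_one]
    nlinarith [abs_nonneg a, abs_nonneg b]
  refine ⟨!₂[x + s, |x + s| ^ γ], hC ⟨by simp, ?_⟩, ?_⟩
  · rw [mem_ball_zero_iff] at hpr ⊢
    have hdiff : |(|x + s| ^ γ) - |x| ^ γ| ≤ γ ^ 2 * |s| := by
      have h1 : |γ * |x| ^ (γ - 2) * x| ≤ γ := by
        rw [abs_mul, abs_mul, abs_of_pos (by linarith : 0 < γ), abs_of_nonneg (by positivity)]
        have e1 : |x| ^ (γ - 2) ≤ 1 := Real.rpow_le_one (abs_nonneg _) (by linarith) (by linarith)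
        have e2 : |x| ^ (γ - 2) * |x| ≤ 1 * 1 := by gcongr; linarith
        rw [mul_assoc]
        nlinarith
      have h2 : |s * (γ * |x| ^ (γ - 2) * x)| ≤ γ * |s| := by
        rw [abs_mul, mul_comm]; gcongr
      have h3 : s ^ 2 ≤ |s| := by rw [← sq_abs]; nlinarith [abs_nonneg s]
      have h4 : γ * (γ - 1) * s ^ 2 ≤ γ * (γ - 1) * |s| := by
        gcongr; nlinarith
      have h5 := abs_add_le (|x + s| ^ γ - |x| ^ γ - s * (γ * |x| ^ (γ - 2) * x))
        (s * (γ * |x| ^ (γ - 2) * x))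
      rw [sub_add_cancel] at h5
      rw [Real.norm_eq_abs] at htay
      nlinarith
    have hsplit : (!₂[x + s, |x + s| ^ γ] : Plane) = p + !₂[s, |x + s| ^ γ - |x| ^ γ] := by
      ext i
      fin_cases i
      · simp [hx]
      · simp [hp]
    rw [hsplit]
    refine (norm_add_le _ _).trans_lt ?_
    have h1 := hsq s (|x + s| ^ γ - |x| ^ γ)
    rw [le_div_iff₀ (by positivity)] at hs2
    nlinarith [abs_nonneg s]
  · have hvec : (!₂[x + s, |x + s| ^ γ] : Plane) - p - s • !₂[1, γ * |x| ^ (γ - 2) * x] =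
        !₂[0, |x + s| ^ γ - |x| ^ γ - s * (γ * |x| ^ (γ - 2) * x)] := by
      ext i
      fin_cases i
      · simp [hx]
      · simp [hp]
    rw [hvec]
    refine (hsq _ _).trans ?_
    rw [abs_zero, zero_add]
    exact htay

/-! ### Sections of a body `C_γ` -/

open Set in
theorem IsCGamma.graph_subset {γ r : ℝ} {C : Set Plane} (hC : IsCGamma γ C)
    (h : frontier C ∩ Metric.ball 0 r = {p : Plane | p 1 = |p 0| ^ γ} ∩ Metric.ball 0 r) :
    {p : Plane | p 1 = |p 0| ^ γ} ∩ Metric.ball 0 r ⊆ C :=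
  h ▸ inter_subset_left.trans hC.isCompact.isClosed.frontier_subset

open Set in
theorem IsCGamma.interior_nonempty {γ : ℝ} (hγ : 2 < γ) {C : Set Plane} (hC : IsCGamma γ C) :
    (interior C).Nonempty := by
  obtain ⟨r, hr, hgraph, -⟩ := hC.boundary
  have hsub := hC.graph_subset hgraph
  -- the triangle spanned by the points of the graph over `0`, `x` and `-x`
  set x := min (1 / 2) (r / 4) with hx
  have hx0 : 0 < x := lt_min (by norm_num) (by positivity)
  have hx1 : x ≤ 1 / 2 := min_le_left _ _
  have hxr : x ≤ r / 4 := min_le_right _ _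
  set g := x ^ γ with hg
  have hg0 : 0 < g := Real.rpow_pos_of_pos hx0 _
  have hgx : g ≤ x := by
    have := Real.rpow_le_rpow_of_exponent_ge hx0 (by linarith) (by linarith : (1 : ℝ) ≤ γ)
    rwa [Real.rpow_one] at this
  have hnorm : ∀ a : ℝ, |a| = x → ‖(!₂[a, g] : Plane)‖ < r := fun a ha => by
    rw [EuclideanSpace.norm_eq, Fin.sum_univ_two, Real.sqrt_lt' hr]
    simp only [Real.norm_eq_abs, Matrix.cons_val_zero, Matrix.cons_val_one, ha,
      abs_of_pos hg0]
    nlinarith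
  have h0 : (0 : Plane) ∈ C := hsub ⟨by simp [Real.zero_rpow (by linarith : γ ≠ 0)], by simpa⟩
  have h1 : (!₂[x, g] : Plane) ∈ C :=
    hsub ⟨by simp [abs_of_pos hx0, hg], mem_ball_zero_iff.2 (hnorm x (abs_of_pos hx0))⟩
  have h2 : (!₂[-x, g] : Plane) ∈ C := hsub ⟨by simp [abs_of_pos hx0, hg],
    mem_ball_zero_iff.2 (hnorm (-x) (by rw [abs_neg, abs_of_pos hx0]))⟩
  set α : Plane → ℝ := fun p => (p 0 / x + p 1 / g) / 2 with hα
  set β : Plane → ℝ := fun p => (p 1 / g - p 0 / x) / 2 with hβ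
  have hαc : Continuous α := by fun_prop
  have hβc : Continuous β := by fun_prop
  have hopen : IsOpen {p : Plane | 0 < α p ∧ 0 < β p ∧ α p + β p < 1} :=
    (isOpen_lt continuous_const hαc).inter ((isOpen_lt continuous_const hβc).inter
      (isOpen_lt (hαc.add hβc) continuous_const))
  refine ⟨!₂[0, g / 2], interior_maximal (fun p hp => ?_) hopen ?_⟩
  · obtain ⟨p1, p2, p3⟩ := hp
    have hab : 0 < α p + β p := by linarith
    have hseg : (α p / (α p + β p)) • (!₂[x, g] : Plane) + (β p / (α p + β p)) • !₂[-x, g] ∈ C :=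
      hC.convex h1 h2 (by positivity) (by positivity) (by field_simp)
    have := hC.convex h0 hseg (sub_nonneg.2 p3.le) hab.le (by ring)
    convert this using 1
    ext i
    fin_cases i
    · simp only [Fin.zero_eta, PiLp.add_apply, PiLp.smul_apply, smul_eq_mul, PiLp.zero_apply,
        Matrix.cons_val_zero]
      field_simp
      simp only [hα, hβ]
      field_simp
      ring
    · simp only [Fin.mk_one, PiLp.add_apply, PiLp.smul_apply, smul_eq_mul, PiLp.zero_apply,
        Matrix.cons_val_one, Matrix.cons_val_fin_one]
      field_simp
      simp only [hα, hβ]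
      field_simp
      ring
  · simp only [mem_ofPred_eq, hα, hβ, Matrix.cons_val_zero, Matrix.cons_val_one,
      Matrix.cons_val_fin_one]
    field_simp
    exact ⟨by linarith, by linarith, by linarith⟩

open Set Filter Topology in
/-- The boundary curvature of a body `C_γ` is bounded above, uniformly. -/
theorem IsCGamma.exists_twoSidedTangent {γ : ℝ} (hγ : 2 < γ) {C : Set Plane}
    (hC : IsCGamma γ C) :
    ∃ M δ : ℝ, 0 < M ∧ 0 < δ ∧ ∀ p ∈ frontier C, TwoSidedTangent C M δ p := by
  obtain ⟨z, hz⟩ := hC.interior_nonempty hγ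
  obtain ⟨r, hr, hgraph, κ, -, hsmooth⟩ := hC.boundary
  have hcl := hC.isCompact.isClosed
  have hcomp : IsCompact (frontier C) :=
    hC.isCompact.of_isClosed_subset isClosed_frontier hcl.frontier_subset
  refine hcomp.induction_on
    (p := fun S => ∃ M δ : ℝ, 0 < M ∧ 0 < δ ∧ ∀ p ∈ S, TwoSidedTangent C M δ p)
    ⟨1, 1, one_pos, one_pos, by simp⟩ ?_ ?_ ?_
  · rintro S T hST ⟨M, δ, hM, hδ, h⟩
    exact ⟨M, δ, hM, hδ, fun p hp => h p (hST hp)⟩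
  · rintro S T ⟨M, δ, hM, hδ, h⟩ ⟨M', δ', hM', hδ', h'⟩
    refine ⟨max M M', min δ δ', lt_max_of_lt_left hM, lt_min hδ hδ', fun p hp => ?_⟩
    rcases hp with hp | hp
    · exact (h p hp).mono (le_max_left _ _) (min_le_left _ _)
    · exact (h' p hp).mono (le_max_right _ _) (min_le_right _ _)
  · intro p hp
    by_cases hpr : p ∈ Metric.ball (0 : Plane) (r / 2)
    · refine ⟨frontier C ∩ Metric.ball 0 (r / 2), inter_mem self_mem_nhdsWithin
        (nhdsWithin_le_nhds (Metric.isOpen_ball.mem_nhds hpr)), γ * (γ - 1),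
        min (1 / 2) (r / (2 * (γ ^ 2 + 2))), by nlinarith, lt_min (by norm_num) (by positivity),
        fun x hx => ?_⟩
      have hxg : x ∈ {p : Plane | p 1 = |p 0| ^ γ} ∩ Metric.ball 0 r :=
        hgraph ▸ ⟨hx.1, Metric.ball_subset_ball (by linarith) hx.2⟩
      have hsq := hC.subset_square x (hcl.frontier_subset hx.1) 0
      exact twoSidedTangent_of_graph hγ (hC.graph_subset hgraph) hxg.1 hx.2
        (abs_le.2 ⟨by linarith [hsq.1], hsq.2.le⟩)
    · obtain ⟨M, δ, hM, hδ, h⟩ :=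
        (hsmooth p hp hpr).twoSidedTangent hC.convex hcl hz hp
      exact ⟨_, h, M, δ, hM, hδ, fun x hx => hx⟩

open Set in
/-- In coordinates: a convex set containing a boundary point `(a, y₁)`, a nearby point at depth
`d ≤ h` and a deep point has a long section at depth `h`. -/
theorem le_sectionLength_of_mem {K : Set (ℝ × ℝ)} (hK : IsCompact K) (hconv : Convex ℝ K)
    {a d h D ρ y₁ y₂ y₃ : ℝ} (h1 : (a, y₁) ∈ K) (h2 : (a + d, y₂) ∈ K) (h3 : (a + D, y₃) ∈ K)
    (hd : 0 ≤ d) (hdh : d ≤ h) (hρ : 0 < ρ) (hhρ : h < ρ) (hρD : ρ ≤ D) (h13 : |y₃ - y₁| ≤ 2)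
    (h23 : |y₃ - y₂| ≤ 2) : |y₂ - y₁| - 4 / ρ * h ≤ sectionLength K (a + h) := by
  have hD : 0 < D := by linarith
  have hDd : 0 < D - d := by linarith
  have hlam : h / D ≤ h / ρ := div_le_div_of_nonneg_left (by linarith) hρ hρD
  have hmu : (h - d) / (D - d) ≤ h / ρ := by
    rw [div_le_div_iff₀ hDd hρ]
    nlinarith
  have hmu0 : 0 ≤ (h - d) / (D - d) := div_nonneg (by linarith) hDd.le
  have hlam0 : 0 ≤ h / D := div_nonneg (by linarith) hD.le
  have hmu1 : (h - d) / (D - d) ≤ 1 := by rw [div_le_one hDd]; linarith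
  have hlam1 : h / D ≤ 1 := by rw [div_le_one hD]; linarith
  have m1 := hconv h1 h3 (sub_nonneg.2 hlam1) hlam0 (by ring)
  have m2 := hconv h2 h3 (sub_nonneg.2 hmu1) hmu0 (by ring)
  simp only [Prod.smul_mk, Prod.mk_add_mk, smul_eq_mul] at m1 m2
  rw [show (1 - h / D) * a + h / D * (a + D) = a + h by field_simp; ring] at m1
  rw [show (1 - (h - d) / (D - d)) * (a + d) + (h - d) / (D - d) * (a + D) = a + h by
    field_simp; ring] at m2
  refine le_trans ?_ (sub_le_sectionLength hK hconv m1 m2)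
  have hhρ0 : 0 ≤ h / ρ := div_nonneg (by linarith) hρ.le
  have e1 : |h / D * (y₃ - y₁)| ≤ h / ρ * 2 := by
    rw [abs_mul, abs_of_nonneg hlam0]; gcongr
  have e2 : |(h - d) / (D - d) * (y₃ - y₂)| ≤ h / ρ * 2 := by
    rw [abs_mul, abs_of_nonneg hmu0]; gcongr
  have e3 : y₂ - y₁ = ((1 - (h - d) / (D - d)) * y₂ + (h - d) / (D - d) * y₃ -
      ((1 - h / D) * y₁ + h / D * y₃)) + (h / D * (y₃ - y₁) - (h - d) / (D - d) * (y₃ - y₂)) := by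
    ring
  have e4 : |y₂ - y₁| ≤ |(1 - (h - d) / (D - d)) * y₂ + (h - d) / (D - d) * y₃ -
      ((1 - h / D) * y₁ + h / D * y₃)| + (h / ρ * 2 + h / ρ * 2) := by
    rw [e3]
    refine (abs_add_le _ _).trans ?_
    gcongr
    exact (abs_sub _ _).trans (add_le_add e1 e2)
  have e5 : 4 / ρ * h = h / ρ * 2 + h / ρ * 2 := by ring
  linarith

/-- A planar set in the coordinates given by an orthonormal basis. -/
def coordSet (v : OrthonormalBasis (Fin 2) ℝ Plane) (C : Set Plane) : Set (ℝ × ℝ) :=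
  (fun z : ℝ × ℝ => z.1 • v 0 + z.2 • v 1) ⁻¹' C

theorem mem_coordSet {v : OrthonormalBasis (Fin 2) ℝ Plane} {C : Set Plane} {x : Plane} :
    (inner ℝ (v 0) x, inner ℝ (v 1) x) ∈ coordSet v C ↔ x ∈ C := by
  have := v.sum_repr' x
  rw [Fin.sum_univ_two] at this
  simp only [coordSet, Set.mem_preimage, this]

theorem inner_coord (v : OrthonormalBasis (Fin 2) ℝ Plane) (z : ℝ × ℝ) :
    inner ℝ (v 0) (z.1 • v 0 + z.2 • v 1) = z.1 ∧
      inner ℝ (v 1) (z.1 • v 0 + z.2 • v 1) = z.2 := by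
  have h01 : inner ℝ (v 0) (v 1) = (0 : ℝ) := v.orthonormal.2 (by decide)
  have h10 : inner ℝ (v 1) (v 0) = (0 : ℝ) := v.orthonormal.2 (by decide)
  simp [inner_add_right, inner_smul_right, h01, h10]

open Set in
theorem isCompact_coordSet (v : OrthonormalBasis (Fin 2) ℝ Plane) {C : Set Plane}
    (hC : IsCompact C) : IsCompact (coordSet v C) := by
  have hc : IsClosed (coordSet v C) := hC.isClosed.preimage (by fun_prop)
  refine (hC.image (f := fun x => (inner ℝ (v 0) x, inner ℝ (v 1) x))
    (by fun_prop)).of_isClosed_subset hc fun z hz => ⟨_, hz, ?_⟩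
  simp only [(inner_coord v z).1, (inner_coord v z).2]

theorem convex_coordSet (v : OrthonormalBasis (Fin 2) ℝ Plane) {C : Set Plane}
    (hC : Convex ℝ C) : Convex ℝ (coordSet v C) := by
  refine hC.is_linear_preimage (IsLinearMap.mk (fun x y => ?_) (fun c x => ?_))
  · simp only [Prod.fst_add, Prod.snd_add]; module
  · simp only [Prod.smul_fst, Prod.smul_snd, smul_eq_mul]; module

open Set in
/-- In every direction, the chords of a body `C_γ` at depth `h` have length at least of order
`√h`, since its boundary curvature is bounded above. -/
theorem IsCGamma.exists_sectionLength {γ : ℝ} (hγ : 2 < γ) {C : Set Plane} (hC : IsCGamma γ C) :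
    ∃ ρ c h₀ : ℝ, 0 < ρ ∧ 0 < c ∧ 0 < h₀ ∧ ∀ v : OrthonormalBasis (Fin 2) ℝ Plane, ∃ a b : ℝ,
      (∀ z ∈ coordSet v C, z.1 ∈ Icc a b) ∧ (∃ z ∈ coordSet v C, z.1 = a) ∧
      (∃ z ∈ coordSet v C, z.1 = b) ∧ ρ ≤ b - a ∧
      ∀ h, 0 < h → h ≤ h₀ → c * √h ≤ sectionLength (coordSet v C) (a + h) := by
  obtain ⟨M, δ, hM, hδ, htan⟩ := hC.exists_twoSidedTangent hγ
  obtain ⟨z, hz⟩ := hC.interior_nonempty hγ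
  obtain ⟨ρ₀, hρ₀, hball⟩ := Metric.isOpen_iff.1 isOpen_interior z hz
  set ρ := ρ₀ / 2 with hρdef
  have hρ : 0 < ρ := by positivity
  have hzC : z ∈ C := interior_subset hz
  have hcl := hC.isCompact.isClosed
  set A := 1 + 4 / ρ with hA
  have hA0 : 0 < A := by positivity
  refine ⟨ρ, 1 / 2 / √M, min (ρ / 2) (min (M * δ ^ 2) (1 / (4 * M * A ^ 2))), hρ, by positivity,
    lt_min (by positivity) (lt_min (by positivity) (by positivity)), fun v => ?_⟩
  have hcont : ContinuousOn (fun x : Plane => (inner ℝ (v 0) x : ℝ)) C := by fun_prop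
  obtain ⟨p, hp, hpmin⟩ := hC.isCompact.exists_isMinOn ⟨z, hzC⟩ hcont
  obtain ⟨p', hp', hpmax⟩ := hC.isCompact.exists_isMaxOn ⟨z, hzC⟩ hcont
  have hpmin : ∀ x ∈ C, (inner ℝ (v 0) p : ℝ) ≤ inner ℝ (v 0) x := fun x hx => hpmin hx
  have hpmax : ∀ x ∈ C, (inner ℝ (v 0) x : ℝ) ≤ inner ℝ (v 0) p' := fun x hx => hpmax hx
  have hv0 : ‖v 0‖ = 1 := v.orthonormal.1 0
  have hv00 : (inner ℝ (v 0) (v 0) : ℝ) = 1 := by rw [real_inner_self_eq_norm_sq, hv0]; norm_num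
  have hv1 : ‖v 1‖ = 1 := v.orthonormal.1 1
  have hinner : ∀ i x, |(inner ℝ (v i) x : ℝ)| ≤ ‖x‖ := fun i x => by
    simpa only [v.orthonormal.1, one_mul] using abs_real_inner_le_norm (v i) x
  -- the interior point `z` lies at depth at least `ρ`
  have hdeep : ρ ≤ inner ℝ (v 0) (z - p) := by
    have hm : z - ρ • v 0 ∈ C := interior_subset (hball (by
      rw [Metric.mem_ball, dist_eq_norm, show z - ρ • v 0 - z = -(ρ • v 0) by abel, norm_neg,
        norm_smul, hv0, Real.norm_eq_abs, abs_of_pos hρ]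
      linarith))
    have := hpmin _ hm
    rw [inner_sub_right, inner_smul_right, hv00] at this
    rw [inner_sub_right]
    linarith
  have hpf : p ∈ frontier C := by
    refine ⟨subset_closure hp, fun hi => ?_⟩
    obtain ⟨ε, hε, hb⟩ := Metric.isOpen_iff.1 isOpen_interior p hi
    have hm : p - (ε / 2) • v 0 ∈ C := interior_subset (hb (by
      rw [Metric.mem_ball, dist_eq_norm, show p - (ε / 2) • v 0 - p = -((ε / 2) • v 0) by abel,
        norm_neg, norm_smul, hv0, Real.norm_eq_abs, abs_of_pos (by positivity)]
      linarith))
    have := hpmin _ hm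
    rw [inner_sub_right, inner_smul_right, hv00] at this
    linarith
  have hdiam : ∀ x ∈ C, ∀ y ∈ C, |(inner ℝ (v 1) x : ℝ) - inner ℝ (v 1) y| ≤ 2 := by
    intro x hx y hy
    rw [← inner_sub_right]
    refine (abs_real_inner_le_norm _ _).trans ?_
    rw [hv1, one_mul, EuclideanSpace.norm_eq, Fin.sum_univ_two]
    refine Real.sqrt_le_iff.2 ⟨by norm_num, ?_⟩
    have a0 := hC.subset_square x hx 0
    have a1 := hC.subset_square x hx 1
    have b0 := hC.subset_square y hy 0
    have b1 := hC.subset_square y hy 1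
    simp only [PiLp.sub_apply, Real.norm_eq_abs, sq_abs]
    have e0 : (x 0 - y 0) ^ 2 ≤ 1 := by
      rw [sq_le_one_iff_abs_le_one, abs_le]; constructor <;> linarith [a0.1, a0.2, b0.1, b0.2]
    have e1 : (x 1 - y 1) ^ 2 ≤ 1 := by
      rw [sq_le_one_iff_abs_le_one, abs_le]; constructor <;> linarith [a1.1, a1.2, b1.1, b1.2]
    linarith
  obtain ⟨e, he, htan⟩ := htan p hpf
  -- the tangent direction is orthogonal to `v 0`
  have horth : (inner ℝ (v 0) e : ℝ) = 0 := by
    have hlow : ∀ s : ℝ, |s| ≤ δ → -(M * s ^ 2) ≤ s * inner ℝ (v 0) e := fun s hs => by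
      obtain ⟨q, hq, hqe⟩ := htan s hs
      have h1 := (abs_le.1 ((hinner 0 (q - p - s • e)).trans hqe)).2
      rw [inner_sub_right, inner_sub_right, inner_smul_right] at h1
      linarith [hpmin q hq]
    by_contra hne
    set t := (inner ℝ (v 0) e : ℝ) with ht
    have htpos : 0 < |t| := abs_pos.2 hne
    -- choose the sign and the size of `s` so that the linear term dominates
    set σ := min δ (|t| / (2 * M)) with hσ
    have hσ0 : 0 < σ := lt_min hδ (by positivity)
    have hσM : M * σ ≤ |t| / 2 := by
      have : σ ≤ |t| / (2 * M) := min_le_right _ _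
      calc M * σ ≤ M * (|t| / (2 * M)) := by gcongr
        _ = |t| / 2 := by field_simp
    rcases abs_cases t with ⟨h1, h2⟩ | ⟨h1, h2⟩
    · have := hlow (-σ) (by rw [abs_neg, abs_of_pos hσ0]; exact min_le_left _ _)
      nlinarith
    · have := hlow σ (by rw [abs_of_pos hσ0]; exact min_le_left _ _)
      nlinarith
  have he1 : 1 ≤ |(inner ℝ (v 1) e : ℝ)| := by
    have := v.sum_sq_norm_inner_right e
    rw [Fin.sum_univ_two, horth, norm_zero, Real.norm_eq_abs] at this
    nlinarith [abs_nonneg (inner ℝ (v 1) e : ℝ)]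
  refine ⟨inner ℝ (v 0) p, inner ℝ (v 0) p', fun y hy => ?_, ⟨_, mem_coordSet.2 hp, rfl⟩,
    ⟨_, mem_coordSet.2 hp', rfl⟩, ?_, fun h h0 hh => ?_⟩
  · have := (inner_coord v y).1
    exact ⟨this ▸ hpmin _ hy, this ▸ hpmax _ hy⟩
  · rw [inner_sub_right] at hdeep
    linarith [hpmax z hzC]
  · have hh1 : h ≤ ρ / 2 := hh.trans (min_le_left _ _)
    have hh2 : h ≤ M * δ ^ 2 := hh.trans ((min_le_right _ _).trans (min_le_left _ _))
    have hh3 : h ≤ 1 / (4 * M * A ^ 2) := hh.trans ((min_le_right _ _).trans (min_le_right _ _))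
    set s := √h / √M with hs
    have hs0 : 0 < s := by positivity
    have hsM : M * s ^ 2 = h := by
      rw [hs, div_pow, Real.sq_sqrt h0.le, Real.sq_sqrt hM.le]; field_simp
    have hsδ : |s| ≤ δ := by
      rw [abs_of_pos hs0]
      by_contra! hlt
      have : δ ^ 2 < s ^ 2 := by gcongr
      nlinarith
    obtain ⟨q, hq, hqe⟩ := htan s hsδ
    rw [hsM] at hqe
    have hd : (inner ℝ (v 0) (q - p) : ℝ) ≤ h := by
      have h1 := (abs_le.1 ((hinner 0 (q - p - s • e)).trans hqe)).2
      rw [inner_sub_right, inner_smul_right, horth] at h1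
      linarith
    have hlat : s - h ≤ |(inner ℝ (v 1) (q - p) : ℝ)| := by
      have h1 := (hinner 1 (q - p - s • e)).trans hqe
      rw [inner_sub_right, inner_smul_right] at h1
      have h2 := abs_sub_abs_le_abs_sub (s * inner ℝ (v 1) e : ℝ) (inner ℝ (v 1) (q - p))
      rw [abs_sub_comm, abs_mul, abs_of_pos hs0] at h2
      nlinarith
    have hK := isCompact_coordSet v hC.isCompact
    have hconv := convex_coordSet v hC.convex
    have hmq := mem_coordSet (v := v).2 hq
    have hmz := mem_coordSet (v := v).2 hzC
    rw [show (inner ℝ (v 0) q : ℝ) = inner ℝ (v 0) p + inner ℝ (v 0) (q - p) by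
      rw [inner_sub_right]; ring] at hmq
    rw [show (inner ℝ (v 0) z : ℝ) = inner ℝ (v 0) p + inner ℝ (v 0) (z - p) by
      rw [inner_sub_right]; ring] at hmz
    have := le_sectionLength_of_mem hK hconv (mem_coordSet.2 hp) hmq hmz
      (by rw [inner_sub_right]; linarith [hpmin q hq]) hd hρ (by linarith) hdeep
      (hdiam z hzC p hp) (hdiam z hzC q hq)
    refine le_trans ?_ this
    rw [← inner_sub_right]
    -- `A h ≤ s / 2` by the choice of the upper bound for `h`
    have hAs : A * h ≤ s / 2 := by
      rw [le_div_iff₀ (by positivity)] at hh3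
      have h1 : (2 * A * h) ^ 2 ≤ s ^ 2 := by
        have : M * (2 * A * h) ^ 2 ≤ M * s ^ 2 := by rw [hsM]; nlinarith
        exact le_of_mul_le_mul_left this hM
      have := abs_le_of_sq_le_sq h1 hs0.le
      linarith [le_abs_self (2 * A * h)]
    have hcs : 1 / 2 / √M * √h = s / 2 := by rw [hs]; ring
    rw [hcs]
    have : A * h = h + 4 / ρ * h := by rw [hA]; ring
    linarith

/-! ### Average decay of the Fourier transform -/

open MeasureTheory in
/-- Integration over a planar set in the coordinates of an orthonormal basis. -/
theorem setIntegral_coordSet (v : OrthonormalBasis (Fin 2) ℝ Plane) (C : Set Plane)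
    (g : Plane → ℂ) :
    ∫ z in coordSet v C, g (z.1 • v 0 + z.2 • v 1) = ∫ x in C, g x := by
  set e : ℝ × ℝ ≃ᵐ Plane := MeasurableEquiv.finTwoArrow.symm.trans
    ((MeasurableEquiv.toLp 2 (Fin 2 → ℝ)).trans v.repr.symm.toHomeomorph.toMeasurableEquiv)
    with he
  have hmp : MeasurePreserving e volume volume :=
    ((volume_preserving_finTwoArrow ℝ).symm _).trans
      (((EuclideanSpace.volume_preserving_symm_measurableEquiv_toLp (Fin 2)).symm _).trans
        v.measurePreserving_repr_symm)
  have hfun : ∀ z, e z = z.1 • v 0 + z.2 • v 1 := fun z => by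
    have h1 : e z = v.repr.symm (!₂[z.1, z.2] : Plane) := rfl
    rw [h1, ← v.sum_repr_symm, Fin.sum_univ_two]
    simp
  have := hmp.setIntegral_preimage_emb e.measurableEmbedding g C
  simp only [hfun] at this
  rw [← this]
  congr 2
  ext z
  simp only [coordSet, Set.mem_preimage, hfun]

open MeasureTheory Complex in
/-- The average decay of the Fourier transform of `C_γ`, from below and in every direction. -/
theorem IsCGamma.exists_le_integral_fourier {γ : ℝ} (hγ : 2 < γ) {C : Set Plane}
    (hC : IsCGamma γ C) : ∃ c q : ℝ, 0 < c ∧ 0 < q ∧ ∀ ξ : Plane, q ≤ ‖ξ‖ →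
      c / ‖ξ‖ ^ 3 ≤ ∫ τ in (1 / 2 : ℝ)..1,
        ‖∫ x in C, exp (-(2 * Real.pi * τ * inner ℝ ξ x : ℝ) * I)‖ ^ 2 := by
  obtain ⟨ρ, c, h₀, hρ, hc, hh₀, hsec⟩ := hC.exists_sectionLength hγ
  have hπ := Real.pi_gt_three
  refine ⟨2 * c ^ 2 / (2520 ^ 2 * (2 * Real.pi) ^ 3), 10000 / ρ + 1 / h₀, by positivity,
    by positivity, fun ξ hξ => ?_⟩
  have hξ0 : 0 < ‖ξ‖ := lt_of_lt_of_le (by positivity) hξ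
  obtain ⟨v, hv⟩ := Orthonormal.exists_orthonormalBasis_extension_of_card_eq (𝕜 := ℝ)
    (E := Plane) (ι := Fin 2) (by simp) (v := fun _ => ‖ξ‖⁻¹ • ξ) (s := {0}) (by
      refine ⟨fun i => ?_, fun i j hij => absurd (Subsingleton.elim i j) hij⟩
      simp [norm_smul, hξ0.ne'])
  have hξv : ξ = ‖ξ‖ • v 0 := by
    rw [hv 0 rfl, smul_smul, mul_inv_cancel₀ hξ0.ne', one_smul]
  obtain ⟨a, b, hab, ha, hb, hw, hlen⟩ := hsec v
  set R := 2 * Real.pi * ‖ξ‖ with hR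
  have hR0 : 0 < R := by positivity
  have hRξ : ‖ξ‖ ≤ R := by rw [hR]; nlinarith
  have hRρ : 10000 ≤ R * (b - a) := by
    have h1 : 10000 / ρ ≤ R := by
      have : 0 < 1 / h₀ := by positivity
      linarith
    rw [div_le_iff₀ hρ] at h1
    exact h1.trans (by gcongr)
  have hRh : 1 / R ≤ h₀ := by
    have h1 : 1 / h₀ ≤ R := by
      have : 0 < 10000 / ρ := by positivity
      linarith
    exact (one_div_le hh₀ hR0).1 h1
  have key := sq_sectionLength_le_integral_fourier (isCompact_coordSet v hC.isCompact)
    (convex_coordSet v hC.convex) hab ha hb hR0 hRρ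
  have hval : ∀ τ : ℝ, ∫ p in coordSet v C, exp (-(R * τ * p.1 : ℝ) * I) =
      ∫ x in C, exp (-(2 * Real.pi * τ * inner ℝ ξ x : ℝ) * I) := fun τ => by
    rw [← setIntegral_coordSet v]
    congr 1
    ext p
    have hin : inner ℝ ξ (p.1 • v 0 + p.2 • v 1) = ‖ξ‖ * p.1 := by
      calc inner ℝ ξ (p.1 • v 0 + p.2 • v 1)
          = inner ℝ (‖ξ‖ • v 0) (p.1 • v 0 + p.2 • v 1) := by rw [← hξv]
        _ = ‖ξ‖ * p.1 := by rw [real_inner_smul_left, (inner_coord v p).1]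
    rw [hin, show R * τ * p.1 = 2 * Real.pi * τ * (‖ξ‖ * p.1) by rw [hR]; ring]
  simp only [hval] at key
  refine le_trans ?_ key
  have h1 := hlen (1 / R) (by positivity) hRh
  calc 2 * c ^ 2 / (2520 ^ 2 * (2 * Real.pi) ^ 3) / ‖ξ‖ ^ 3
      = 2 * (c * √(1 / R) / (2520 * R)) ^ 2 := by
        rw [div_pow, mul_pow c, Real.sq_sqrt (by positivity), hR]
        field_simp
    _ ≤ _ := by gcongr

/-! ### Discrepancy on the torus -/

section TorusFourier

open MeasureTheory Set

/-- Haar probability measure on the circle, the normalization used for Fourier series. -/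
noncomputable local instance : MeasureSpace UnitAddCircle := ⟨AddCircle.haarAddCircle⟩

local instance : Measure.IsAddHaarMeasure (volume : Measure UnitAddCircle) :=
  inferInstanceAs (Measure.IsAddHaarMeasure AddCircle.haarAddCircle)

local instance : IsProbabilityMeasure (volume : Measure UnitAddCircle) :=
  inferInstanceAs (IsProbabilityMeasure AddCircle.haarAddCircle)

local instance : Measure.IsNegInvariant (volume : Measure (UnitAddTorus (Fin 2))) :=
  Pi.isNegInvariant_volume

/-- Bessel's inequality for a bounded function on the torus. -/
theorem sum_sq_mFourierCoeff_le {f : UnitAddTorus (Fin 2) → ℂ} (hf : Measurable f) {B : ℝ}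
    (hB : ∀ y, ‖f y‖ ≤ B) (s : Finset (Fin 2 → ℤ)) :
    ∑ n ∈ s, ‖UnitAddTorus.mFourierCoeff f n‖ ^ 2 ≤ B ^ 2 := by
  have hm : MemLp f 2 volume :=
    MemLp.of_bound hf.aestronglyMeasurable B (Filter.Eventually.of_forall hB)
  have h1 := UnitAddTorus.hasSum_sq_mFourierCoeff hm.toLp
  have h2 : ∀ n, UnitAddTorus.mFourierCoeff (hm.toLp : UnitAddTorus (Fin 2) → ℂ) n =
      UnitAddTorus.mFourierCoeff f n := fun n => by
    refine integral_congr_ae ?_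
    filter_upwards [hm.coeFn_toLp] with y hy
    rw [hy]
  simp only [h2] at h1
  refine (sum_le_hasSum s (fun _ _ => by positivity) h1).trans ?_
  have h3 : ∫ t, ‖(hm.toLp : UnitAddTorus (Fin 2) → ℂ) t‖ ^ 2 ≤
      ∫ _ : UnitAddTorus (Fin 2), B ^ 2 := by
    refine integral_mono_of_nonneg (Filter.Eventually.of_forall fun _ => by positivity)
      (by simp) ?_
    filter_upwards [hm.coeFn_toLp] with y hy
    simp only [hy]
    have := hB y
    gcongr
  simpa using h3

/-- The image of a point of the plane in the torus. -/
def toTorus (x : Plane) : UnitAddTorus (Fin 2) := fun i => (x i : UnitAddCircle)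

theorem mem_periodization_iff {A : Set Plane} {x : Plane} :
    x ∈ periodization A ↔ toTorus x ∈ toTorus '' A := by
  constructor
  · rintro ⟨m, hm⟩
    refine ⟨_, hm, ?_⟩
    ext i
    simp [toTorus]
  · rintro ⟨a, ha, h⟩
    have : ∀ i, ∃ m : ℤ, x i - a i = m := fun i => by
      have h1 : ((x i - a i : ℝ) : UnitAddCircle) = 0 := by
        rw [AddCircle.coe_sub, sub_eq_zero]; exact (congrFun h i).symm
      obtain ⟨m, hm⟩ := (AddCircle.coe_eq_zero_iff (p := (1 : ℝ))).1 h1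
      exact ⟨m, by rw [← hm]; simp⟩
    choose m hm using this
    refine ⟨m, ?_⟩
    convert ha using 1
    ext i
    simp [← hm]

theorem toTorus_surjective : Function.Surjective toTorus := fun y => by
  choose t ht using fun i => QuotientAddGroup.mk_surjective (y i)
  exact ⟨WithLp.toLp 2 t, funext ht⟩

theorem toTorus_sub (x y : Plane) : toTorus (x - y) = toTorus x - toTorus y := by
  ext i
  simp [toTorus]

theorem mFourier_toTorus (n : Fin 2 → ℤ) (x : Plane) :
    UnitAddTorus.mFourier n (toTorus x) =
      Complex.exp ((2 * Real.pi * (n 0 * x 0 + n 1 * x 1) : ℝ) * Complex.I) := by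
  simp only [UnitAddTorus.mFourier, ContinuousMap.coe_mk, toTorus, Fin.prod_univ_two,
    fourier_coe_apply, ← Complex.exp_add]
  congr 1
  push_cast
  ring

theorem norm_mFourier (n : Fin 2 → ℤ) (y : UnitAddTorus (Fin 2)) :
    ‖UnitAddTorus.mFourier n y‖ = 1 := by
  obtain ⟨x, rfl⟩ := toTorus_surjective y
  rw [mFourier_toTorus, Complex.norm_exp_ofReal_mul_I]

theorem mFourier_neg_sub (n : Fin 2 → ℤ) (x y : UnitAddTorus (Fin 2)) :
    UnitAddTorus.mFourier (-n) (x - y) =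
      UnitAddTorus.mFourier (-n) x * UnitAddTorus.mFourier n y := by
  obtain ⟨x, rfl⟩ := toTorus_surjective x
  obtain ⟨y, rfl⟩ := toTorus_surjective y
  rw [← toTorus_sub, mFourier_toTorus, mFourier_toTorus, mFourier_toTorus, ← Complex.exp_add]
  congr 1
  simp only [Pi.neg_apply, PiLp.sub_apply]
  push_cast
  ring

theorem integral_mFourier_neg {n : Fin 2 → ℤ} (hn : n ≠ 0) :
    ∫ y, UnitAddTorus.mFourier (-n) y = 0 := by
  have := (UnitAddTorus.orthonormal_mFourier (d := Fin 2)).2 hn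
  simp only [ContinuousMap.inner_toLp, ← UnitAddTorus.mFourier_neg,
    ← UnitAddTorus.mFourier_add] at this
  simpa using this

/-- A set inside the open unit square centred at the origin is, on the torus, read off from the
representatives in `(-1/2, 1/2]²`. -/
theorem toTorus_mem_image_iff {A : Set Plane}
    (hA : ∀ p ∈ A, ∀ i, p i ∈ Ioo (-(1 / 2) : ℝ) (1 / 2)) {x : Plane}
    (hx : ∀ i, x i ∈ Ioc (-(1 / 2) : ℝ) (-(1 / 2) + 1)) :
    toTorus x ∈ toTorus '' A ↔ x ∈ A := by
  refine ⟨?_, fun h => mem_image_of_mem _ h⟩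
  rintro ⟨a, ha, h⟩
  convert ha using 1
  ext i
  have hai := hA a ha i
  exact (AddCircle.coe_eq_coe_iff_of_mem_Ioc (p := (1 : ℝ)) (a := -(1 / 2)) (hx i)
    ⟨hai.1, by linarith [hai.2]⟩).1 (congrFun h i).symm

theorem measurableSet_toTorus_image {A : Set Plane} (hm : MeasurableSet A)
    (hA : ∀ p ∈ A, ∀ i, p i ∈ Ioo (-(1 / 2) : ℝ) (1 / 2)) : MeasurableSet (toTorus '' A) := by
  set e := UnitAddTorus.measurableEquivPiIoc (fun _ : Fin 2 => (-(1 / 2) : ℝ)) with he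
  have : toTorus '' A = (fun y => WithLp.toLp 2 (e y).1) ⁻¹' A := by
    ext y
    have hy : toTorus (WithLp.toLp 2 (e y).1) = y := e.symm_apply_apply y
    rw [mem_preimage, ← toTorus_mem_image_iff hA (x := WithLp.toLp 2 (e y).1) (e y).2, hy]
  rw [this]
  exact ((MeasurableEquiv.toLp 2 (Fin 2 → ℝ)).measurable.comp
    (measurable_subtype_coe.comp e.measurable)) hm

/-- Fourier coefficients of (the indicator of) a small set on the torus are Fourier integrals over
the plane. -/
theorem integral_mFourier_indicator {A : Set Plane} (hm : MeasurableSet A)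
    (hA : ∀ p ∈ A, ∀ i, p i ∈ Ioo (-(1 / 2) : ℝ) (1 / 2)) (n : Fin 2 → ℤ) :
    ∫ y, UnitAddTorus.mFourier n y * (toTorus '' A).indicator (fun _ => (1 : ℂ)) y =
      ∫ x in A, Complex.exp ((2 * Real.pi * (n 0 * x 0 + n 1 * x 1) : ℝ) * Complex.I) := by
  rw [UnitAddTorus.integral_preimage _ (fun _ => (-(1 / 2) : ℝ))]
  have hbox : MeasurableSet {x : Fin 2 → ℝ | ∀ i, x i ∈ Ioc (-(1 / 2) : ℝ) (-(1 / 2) + 1)} :=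
    MeasurableSet.univ_pi' fun _ => measurableSet_Ioc
  rw [← (EuclideanSpace.volume_preserving_symm_measurableEquiv_toLp (Fin 2)).symm
    |>.setIntegral_preimage_emb (MeasurableEquiv.measurableEmbedding _),
    ← integral_indicator hbox, ← integral_indicator (MeasurableEquiv.measurable _ hm)]
  congr 1
  ext x
  by_cases hx : x ∈ {x : Fin 2 → ℝ | ∀ i, x i ∈ Ioc (-(1 / 2) : ℝ) (-(1 / 2) + 1)}
  · rw [indicator_of_mem hx]
    have h1 : (fun i => (x i : UnitAddCircle)) = toTorus (WithLp.toLp 2 x) := rfl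
    have h2 := toTorus_mem_image_iff hA (x := WithLp.toLp 2 x) hx
    rw [h1, mFourier_toTorus]
    by_cases hxA : (WithLp.toLp 2 x : Plane) ∈ A
    · rw [indicator_of_mem (h2.2 hxA), indicator_of_mem (by exact hxA), mul_one]
      rfl
    · rw [indicator_of_notMem (mt h2.1 hxA), indicator_of_notMem (by exact hxA), mul_zero]
  · rw [indicator_of_notMem hx, indicator_of_notMem]
    exact fun h => hx fun i => by
      have : x i ∈ Ioo (-(1 / 2) : ℝ) (1 / 2) := hA _ h i
      exact ⟨this.1, by linarith [this.2]⟩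

/-- If all translates of a small set have discrepancy at most `B`, then the exponential sums of the
points, weighted by the Fourier transform of the set, are bounded in mean square. -/
theorem sum_sq_expSum_mul_le {A : Set Plane} (hm : MeasurableSet A)
    (hA : ∀ p ∈ A, ∀ i, p i ∈ Ioo (-(1 / 2) : ℝ) (1 / 2)) {N : ℕ} (u : Fin N → Plane) {B V : ℝ}
    (hB : ∀ t : Plane, |-(N * V) +
      ∑ j, (periodization ((fun x => x + t) '' A)).indicator (fun _ => (1 : ℝ)) (u j)| ≤ B)
    (s : Finset (Fin 2 → ℤ)) (hs : 0 ∉ s) :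
    ∑ n ∈ s, ‖∑ j, UnitAddTorus.mFourier (-n) (toTorus (u j))‖ ^ 2 *
      ‖∫ x in A, Complex.exp ((2 * Real.pi * (n 0 * x 0 + n 1 * x 1) : ℝ) * Complex.I)‖ ^ 2 ≤
        B ^ 2 := by
  set χ : UnitAddTorus (Fin 2) → ℂ := (toTorus '' A).indicator (fun _ => (1 : ℂ)) with hχ
  have hχm : Measurable χ := measurable_const.indicator (measurableSet_toTorus_image hm hA)
  set f : UnitAddTorus (Fin 2) → ℂ := fun y => -(N * V : ℝ) + ∑ j, χ (toTorus (u j) - y) with hf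
  have hsub : ∀ x : UnitAddTorus (Fin 2), Measurable fun y => x - y := fun x =>
    (continuous_const.sub continuous_id).measurable
  have hfm : Measurable f :=
    measurable_const.add (Finset.measurable_sum _ fun j _ =>
      hχm.comp (hsub _))
  have hfB : ∀ y, ‖f y‖ ≤ B := fun y => by
    obtain ⟨t, rfl⟩ := toTorus_surjective y
    have h1 : ∀ j, χ (toTorus (u j) - toTorus t) =
        ((periodization ((fun x => x + t) '' A)).indicator (fun _ => (1 : ℝ)) (u j) : ℝ) := by
      intro j
      have h2 : toTorus (u j) - toTorus t ∈ toTorus '' A ↔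
          u j ∈ periodization ((fun x => x + t) '' A) := by
        rw [mem_periodization_iff, image_image]
        constructor
        · rintro ⟨a, ha, h⟩
          refine ⟨a, ha, ?_⟩
          have : toTorus (a + t) = toTorus a + toTorus t := by ext i; simp [toTorus]
          change toTorus (a + t) = _
          rw [this, h, sub_add_cancel]
        · rintro ⟨a, ha, h⟩
          refine ⟨a, ha, ?_⟩
          have : toTorus (a + t) = toTorus a + toTorus t := by ext i; simp [toTorus]
          change toTorus (a + t) = _ at h
          rw [← h, this, add_sub_cancel_right]
      by_cases h : toTorus (u j) - toTorus t ∈ toTorus '' A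
      · rw [hχ, indicator_of_mem h, indicator_of_mem (h2.1 h), Complex.ofReal_one]
      · rw [hχ, indicator_of_notMem h, indicator_of_notMem (mt h2.2 h), Complex.ofReal_zero]
    have := hB t
    simp only [hf, h1]
    rwa [← Complex.ofReal_sum, ← Complex.ofReal_neg, ← Complex.ofReal_add, Complex.norm_real]
  refine le_trans (le_of_eq ?_) (sum_sq_mFourierCoeff_le hfm hfB s)
  refine Finset.sum_congr rfl fun n hn => ?_
  have hn0 : n ≠ 0 := fun h => hs (h ▸ hn)
  rw [← mul_pow, ← norm_mul]
  congr 2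
  have hbdd : ∀ g : UnitAddTorus (Fin 2) → ℂ, Measurable g → (∀ y, ‖g y‖ ≤ 1) →
      Integrable (fun y => UnitAddTorus.mFourier (-n) y * g y) := fun g hg hg1 =>
    Integrable.of_bound ((UnitAddTorus.mFourier (-n)).continuous.measurable.mul
      hg).aestronglyMeasurable 1 (Filter.Eventually.of_forall fun y => by
        rw [norm_mul, norm_mFourier, one_mul]; exact hg1 y)
  have hχ1 : ∀ y, ‖χ y‖ ≤ 1 := fun y => by
    rw [hχ, indicator]; split_ifs <;> simp
  have hcoef : ∀ j, ∫ y, UnitAddTorus.mFourier (-n) y * χ (toTorus (u j) - y) =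
      UnitAddTorus.mFourier (-n) (toTorus (u j)) *
        ∫ x in A, Complex.exp ((2 * Real.pi * (n 0 * x 0 + n 1 * x 1) : ℝ) * Complex.I) := by
    intro j
    rw [← integral_mFourier_indicator hm hA, ← integral_const_mul,
      ← integral_sub_left_eq_self _ volume (toTorus (u j))]
    congr 1
    ext y
    rw [sub_sub_cancel, mFourier_neg_sub, mul_assoc]
  have hj : ∀ j, Integrable (fun y => UnitAddTorus.mFourier (-n) y * χ (toTorus (u j) - y)) :=
    fun j => hbdd _ (hχm.comp (hsub _)) fun y => hχ1 _
  have hexp : ∀ y, UnitAddTorus.mFourier (-n) y * f y =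
      UnitAddTorus.mFourier (-n) y * -(N * V : ℝ) +
        ∑ j, UnitAddTorus.mFourier (-n) y * χ (toTorus (u j) - y) := fun y => by
    simp only [hf, mul_add, Finset.mul_sum]
  simp only [UnitAddTorus.mFourierCoeff, smul_eq_mul, hexp]
  rw [integral_add, integral_finsetSum _ fun j _ => hj j, integral_mul_const, integral_mFourier_neg hn0, zero_mul,
    zero_add, Finset.sum_mul]
  · simp only [hcoef]
  · exact ((UnitAddTorus.mFourier (-n)).continuous.integrable_of_hasCompactSupport
      (HasCompactSupport.of_compactSpace _)).mul_const _
  · exact integrable_finsetSum _ fun j _ => hj j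

end TorusFourier

/-! ### Exponential sums and the lower bound for the discrepancy -/

open ComplexConjugate in
/-- A Gram matrix and its dual have the same sum of squares. -/
theorem sum_sq_gram_eq {ι κ : Type*} [Fintype ι] [Fintype κ] (χ : ι → κ → ℂ) :
    ∑ b, ∑ a, ‖∑ j, χ a j * conj (χ b j)‖ ^ 2 = ∑ j, ∑ l, ‖∑ a, χ a j * conj (χ a l)‖ ^ 2 := by
  have h : ((∑ b, ∑ a, ‖∑ j, χ a j * conj (χ b j)‖ ^ 2 : ℝ) : ℂ) =
      ((∑ j, ∑ l, ‖∑ a, χ a j * conj (χ a l)‖ ^ 2 : ℝ) : ℂ) := by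
    push_cast
    simp only [← Complex.mul_conj', map_sum, Finset.sum_mul_sum, ← Fintype.sum_prod_type']
    refine Fintype.sum_equiv (⟨fun x => (x.2.2.1, x.2.2.2, x.2.1, x.1),
      fun y => (y.2.2.2, y.2.2.1, y.1, y.2.1), fun _ => rfl, fun _ => rfl⟩ :
      ι × ι × κ × κ ≃ κ × κ × ι × ι) _ _ fun x => ?_
    simp only [Equiv.coe_fn_mk, map_mul, Complex.conj_conj]
    ring
  exact_mod_cast h

open ComplexConjugate in
/-- The Cassels–Montgomery lower bound in its abstract form: if the number of unimodular characters
exceeds twice the number of points, then the exponential sums of the points, over the differences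
with one of the characters, are large in mean square. -/
theorem exists_le_sum_sq_expSum {ι : Type*} [Fintype ι] [DecidableEq ι] [Nonempty ι] {N : ℕ}
    (χ : ι → Fin N → ℂ) (hχ : ∀ a j, ‖χ a j‖ = 1) (hN : 2 * N ≤ Fintype.card ι) :
    ∃ b, (N * Fintype.card ι / 2 : ℝ) ≤
      ∑ a ∈ Finset.univ.erase b, ‖∑ j, χ a j * conj (χ b j)‖ ^ 2 := by
  by_contra! h
  have h1 : ∀ b, ∑ a, ‖∑ j, χ a j * conj (χ b j)‖ ^ 2 < N * Fintype.card ι / 2 + N ^ 2 := by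
    intro b
    rw [← Finset.sum_erase_add _ _ (Finset.mem_univ b)]
    have : ∀ j, χ b j * conj (χ b j) = 1 := fun j => by rw [Complex.mul_conj', hχ]; simp
    refine add_lt_add_of_lt_of_le (h b) ?_
    simp [this]
  have h2 := Finset.sum_lt_sum_of_nonempty (Finset.univ_nonempty (α := ι)) fun b _ => h1 b
  rw [sum_sq_gram_eq, Finset.sum_const, Finset.card_univ, nsmul_eq_mul] at h2
  have h3 : (N * Fintype.card ι ^ 2 : ℝ) ≤ ∑ j, ∑ l, ‖∑ a, χ a j * conj (χ a l)‖ ^ 2 := by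
    have : ∀ j : Fin N, (Fintype.card ι ^ 2 : ℝ) ≤ ∑ l, ‖∑ a, χ a j * conj (χ a l)‖ ^ 2 := by
      intro j
      refine le_trans (le_of_eq ?_) (Finset.single_le_sum (fun l _ => by positivity)
        (Finset.mem_univ j))
      have : ∀ a, χ a j * conj (χ a j) = 1 := fun a => by rw [Complex.mul_conj', hχ]; simp
      simp [this]
    have := Finset.sum_le_sum fun j (_ : j ∈ Finset.univ) => this j
    simpa using this
  have h4 : (2 * N : ℝ) ≤ Fintype.card ι := by exact_mod_cast hN
  have h5 : (0 : ℝ) ≤ N * Fintype.card ι := by positivity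
  nlinarith

open MeasureTheory Set Complex in
theorem setIntegral_smul_image {τ : ℝ} (hτ : τ ≠ 0) (C : Set Plane) (f : Plane → ℂ) :
    ∫ x in (fun x => τ • x) '' C, f x = (τ ^ 2 : ℝ) • ∫ x in C, f (τ • x) := by
  have h := Measure.setIntegral_comp_smul (volume : Measure Plane) f C hτ
  rw [finrank_euclideanSpace_fin, abs_of_nonneg (by positivity)] at h
  rw [h, smul_smul, mul_inv_cancel₀ (by positivity), one_smul]
  rfl

open MeasureTheory Set ComplexConjugate in
theorem mainTheorem2 (γ : ℝ) (hγ : 2 < γ) (C : Set Plane) (hC : IsCGamma γ C) :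
    ∃ c : ℝ, 0 < c ∧
      ∀ (N : ℕ), 1 ≤ N → ∀ u : Fin N → Plane,
        (∀ j i, u j i ∈ Set.Ico (-(1 / 2) : ℝ) (1 / 2)) →
        ∃ τ ∈ Set.Icc (1 / 2 : ℝ) 1, ∃ t : Plane,
          c * (N : ℝ) ^ (1 / 4 : ℝ) ≤
            |-((N : ℝ) * MeasureTheory.volume.real (dilatedTranslate τ t C)) +
              ∑ j, (periodization (dilatedTranslate τ t C)).indicator (fun _ => (1 : ℝ)) (u j)| := by
  obtain ⟨c₁, q₀, hc₁, hq₀, hfourier⟩ := hC.exists_le_integral_fourier hγ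
  -- all frequencies used are multiples of `q`, which avoids the small ones
  set q := ⌈q₀⌉₊ with hq
  have hqq : q₀ ≤ q := Nat.le_ceil _
  have hq1 : 0 < q := Nat.ceil_pos.2 hq₀
  have hq1' : (0 : ℝ) < q := by exact_mod_cast hq1
  refine ⟨√(c₁ / (400 * q ^ 3)), by positivity, fun N hN u _ => ?_⟩
  by_contra! hcon
  have hN0 : (0 : ℝ) < N := by exact_mod_cast hN
  set B := √(c₁ / (400 * q ^ 3)) * (N : ℝ) ^ (1 / 4 : ℝ) with hB
  have hB2 : B ^ 2 = c₁ / (400 * q ^ 3) * √N := by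
    rw [hB, mul_pow, Real.sq_sqrt (by positivity), ← Real.rpow_natCast ((N : ℝ) ^ (1 / 4 : ℝ)),
      ← Real.rpow_mul hN0.le, Real.sqrt_eq_rpow]
    norm_num
  -- the side of the box of frequencies, so that their number exceeds `2 * N`
  set X := Nat.sqrt (2 * N) + 1 with hX
  have hX0 : (0 : ℝ) < X := by positivity
  have hXN : 2 * N ≤ X ^ 2 := (Nat.lt_succ_sqrt' (2 * N)).le
  have hXs : (X : ℝ) ≤ 3 * √N := by
    have h1 : 1 ≤ √(N : ℝ) := Real.one_le_sqrt.2 (by exact_mod_cast hN)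
    have h2 : ((Nat.sqrt (2 * N) : ℕ) : ℝ) ≤ 2 * √N := by
      refine abs_le_of_sq_le_sq ?_ (by positivity) |>.trans' (le_abs_self _)
      rw [mul_pow, Real.sq_sqrt hN0.le]
      have : Nat.sqrt (2 * N) ^ 2 ≤ 2 * N := Nat.sqrt_le' _
      have : ((Nat.sqrt (2 * N) : ℕ) : ℝ) ^ 2 ≤ 2 * N := by exact_mod_cast this
      linarith
    rw [hX]; push_cast; linarith
  -- multiples of `q` in a box, and one of them from which differences are taken
  set w : (Fin 2 → Fin X) → Fin 2 → ℤ := fun a i => q * (a i : ℕ) with hw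
  have hcard : Fintype.card (Fin 2 → Fin X) = X ^ 2 := by simp
  obtain ⟨b, hb⟩ := exists_le_sum_sq_expSum
    (fun a j => UnitAddTorus.mFourier (-(w a)) (toTorus (u j))) (fun a j => norm_mFourier _ _)
    (by rw [hcard]; exact hXN)
  have hwsub : ∀ a, ∀ i, |(w a i - w b i : ℤ)| ≤ q * X := fun a i => by
    have h1 := (a i).2
    have h2 := (b i).2
    simp only [hw]
    rw [← mul_sub, abs_mul, abs_of_nonneg (by positivity)]
    gcongr
    rw [abs_le]
    omega
  have hinj : Function.Injective fun a => w a - w b := fun a a' h => by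
    ext i
    have := congrFun h i
    simp only [Pi.sub_apply, sub_left_inj, hw] at this
    have h2 := mul_left_cancel₀ (by exact_mod_cast hq1.ne') this
    exact_mod_cast h2
  set ξ : (Fin 2 → Fin X) → Plane := fun a => WithLp.toLp 2 fun i => -((w a i - w b i : ℤ) : ℝ)
    with hξ
  have hξle : ∀ a, ‖ξ a‖ ≤ 2 * q * X := fun a => by
    have h : ∀ i, |ξ a i| ≤ q * X := fun i => by
      simp only [hξ, abs_neg]
      exact_mod_cast hwsub a i
    rw [EuclideanSpace.norm_eq, Fin.sum_univ_two]
    refine Real.sqrt_le_iff.2 ⟨by positivity, ?_⟩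
    have h0 := pow_le_pow_left₀ (abs_nonneg _) (h 0) 2
    have h1 := pow_le_pow_left₀ (abs_nonneg _) (h 1) 2
    rw [Real.norm_eq_abs, Real.norm_eq_abs]
    nlinarith
  have hξge : ∀ a ≠ b, q₀ ≤ ‖ξ a‖ := fun a hab => by
    obtain ⟨i, hi⟩ := Function.ne_iff.1 hab
    refine hqq.trans (le_trans ?_ (PiLp.norm_apply_le (ξ a) i))
    simp only [hξ, norm_neg, Real.norm_eq_abs, hw]
    have h1 : (1 : ℤ) ≤ |((a i : ℕ) - (b i : ℕ) : ℤ)| := by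
      refine Int.one_le_abs (sub_ne_zero.2 ?_)
      exact_mod_cast fun h => hi (Fin.ext h)
    have h2 : (q : ℤ) ≤ |(q * (a i : ℕ) - q * (b i : ℕ) : ℤ)| := by
      rw [← mul_sub, abs_mul, abs_of_nonneg (by positivity : (0 : ℤ) ≤ q)]
      exact le_mul_of_one_le_right (by positivity) h1
    exact_mod_cast h2
  set J : (Fin 2 → Fin X) → ℝ → ℂ := fun a τ =>
    ∫ x in C, Complex.exp (-(2 * Real.pi * τ * inner ℝ (ξ a) x : ℝ) * Complex.I) with hJ
  have hJc : ∀ a, Continuous (J a) := fun a =>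
    continuous_parametric_integral_of_continuous (f := fun (τ : ℝ) (x : Plane) =>
      Complex.exp (-(2 * Real.pi * τ * inner ℝ (ξ a) x : ℝ) * Complex.I)) (by fun_prop)
      hC.isCompact
  set S : (Fin 2 → Fin X) → ℂ := fun a => ∑ j, UnitAddTorus.mFourier (-(w a)) (toTorus (u j)) *
    conj (UnitAddTorus.mFourier (-(w b)) (toTorus (u j))) with hS
  -- Bessel's inequality for each dilation parameter
  have hbessel : ∀ τ ∈ Icc (1 / 2 : ℝ) 1,
      ∑ a ∈ Finset.univ.erase b, ‖S a‖ ^ 2 * ‖J a τ‖ ^ 2 ≤ 16 * B ^ 2 := by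
    intro τ hτ
    have hτ0 : 0 < τ := by linarith [hτ.1]
    set A := (fun x : Plane => τ • x) '' C with hA
    have hdil : ∀ t, dilatedTranslate τ t C = (fun x => x + t) '' A := fun t => by
      rw [hA, image_image]; rfl
    have hAc : IsCompact A := hC.isCompact.image (by fun_prop)
    have hAsq : ∀ p ∈ A, ∀ i, p i ∈ Ioo (-(1 / 2) : ℝ) (1 / 2) := by
      rintro _ ⟨x, hx, rfl⟩ i
      have := hC.subset_square x hx i
      simp only [PiLp.smul_apply, smul_eq_mul]
      constructor <;> nlinarith [this.1, this.2, hτ.2]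
    have hvol : ∀ t, volume.real (dilatedTranslate τ t C) = volume.real A := fun t => by
      rw [hdil, image_add_right, measureReal_def, measure_preimage_add_right, measureReal_def]
    have key := sum_sq_expSum_mul_le hAc.measurableSet hAsq u (B := B) (V := volume.real A)
      (fun t => by
        have := (hcon τ hτ t).le
        rwa [hvol, hdil] at this)
      ((Finset.univ.erase b).image fun a => w a - w b) (by
        intro h
        obtain ⟨a, ha, h0⟩ := Finset.mem_image.1 h
        exact (Finset.mem_erase.1 ha).1 (hinj (by simpa using h0)))
    rw [Finset.sum_image hinj.injOn] at key
    have hterm : ∀ a, ‖S a‖ ^ 2 * ‖J a τ‖ ^ 2 ≤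
        16 * (‖∑ j, UnitAddTorus.mFourier (-(w a - w b)) (toTorus (u j))‖ ^ 2 *
          ‖∫ x in A, Complex.exp ((2 * Real.pi * (((w a - w b) 0 : ℤ) * x 0 +
            ((w a - w b) 1 : ℤ) * x 1) : ℝ) * Complex.I)‖ ^ 2) := by
      intro a
      have e1 : S a = ∑ j, UnitAddTorus.mFourier (-(w a - w b)) (toTorus (u j)) := by
        refine Finset.sum_congr rfl fun j _ => ?_
        rw [← UnitAddTorus.mFourier_neg, ← UnitAddTorus.mFourier_add]
        congr 1
        congr 1
        abel
      have e2 : ∫ x in A, Complex.exp ((2 * Real.pi * (((w a - w b) 0 : ℤ) * x 0 +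
          ((w a - w b) 1 : ℤ) * x 1) : ℝ) * Complex.I) = (τ ^ 2 : ℝ) • J a τ := by
        rw [hA, setIntegral_smul_image hτ0.ne']
        congr 2
        ext x
        have : inner ℝ (ξ a) x = -(((w a - w b) 0 : ℤ) * x 0 + ((w a - w b) 1 : ℤ) * x 1 : ℝ) := by
          rw [PiLp.inner_apply, Fin.sum_univ_two]
          simp [hξ]
          ring
        rw [this]
        simp only [PiLp.smul_apply, smul_eq_mul]
        congr 1
        push_cast
        ring
      rw [e2, ← e1, norm_smul, Real.norm_eq_abs, abs_of_nonneg (by positivity), mul_pow]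
      have h16 : 1 ≤ 16 * (τ ^ 2) ^ 2 := by
        have h1 : (1 / 2 : ℝ) ^ 4 ≤ τ ^ 4 := pow_le_pow_left₀ (by norm_num) hτ.1 4
        have h2 : (τ ^ 2) ^ 2 = τ ^ 4 := by ring
        rw [h2]; linarith
      have := le_mul_of_one_le_left (by positivity : 0 ≤ ‖S a‖ ^ 2 * ‖J a τ‖ ^ 2) h16
      linarith
    refine (Finset.sum_le_sum fun a _ => hterm a).trans ?_
    rw [← Finset.mul_sum]
    gcongr
  -- average over the dilation parameter and insert the lower bound for the Fourier transform
  have hint : ∑ a ∈ Finset.univ.erase b, ‖S a‖ ^ 2 * ∫ τ in (1 / 2 : ℝ)..1, ‖J a τ‖ ^ 2 ≤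
      8 * B ^ 2 := by
    have h1 : ∫ τ in (1 / 2 : ℝ)..1, ∑ a ∈ Finset.univ.erase b, ‖S a‖ ^ 2 * ‖J a τ‖ ^ 2 ≤
        ∫ τ in (1 / 2 : ℝ)..1, 16 * B ^ 2 :=
      intervalIntegral.integral_mono_on (by norm_num)
        ((by fun_prop : Continuous fun τ =>
          ∑ a ∈ Finset.univ.erase b, ‖S a‖ ^ 2 * ‖J a τ‖ ^ 2).intervalIntegrable _ _)
        (by simp) hbessel
    rw [intervalIntegral.integral_finsetSum fun a _ =>
      (by fun_prop : Continuous fun τ => ‖S a‖ ^ 2 * ‖J a τ‖ ^ 2).intervalIntegrable _ _,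
      intervalIntegral.integral_const, smul_eq_mul] at h1
    simp only [intervalIntegral.integral_const_mul] at h1
    linarith
  have hlow : (∑ a ∈ Finset.univ.erase b, ‖S a‖ ^ 2) * (c₁ / (2 * q * X) ^ 3) ≤ 8 * B ^ 2 := by
    refine le_trans ?_ hint
    rw [Finset.sum_mul]
    refine Finset.sum_le_sum fun a ha => ?_
    have hab := (Finset.mem_erase.1 ha).1
    have hpos : 0 < ‖ξ a‖ := hq₀.trans_le (hξge a hab)
    refine mul_le_mul_of_nonneg_left (le_trans ?_ (hfourier (ξ a) (hξge a hab))) (by positivity)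
    have := hξle a
    gcongr
  rw [hcard] at hb
  have hfin := (mul_le_mul_of_nonneg_right hb
    (by positivity : 0 ≤ c₁ / (2 * (q : ℝ) * X) ^ 3)).trans hlow
  have e1 : (N * (X ^ 2 : ℕ) / 2 : ℝ) * (c₁ / (2 * q * X) ^ 3) = N * c₁ / (16 * q ^ 3 * X) := by
    push_cast; field_simp; norm_num
  rw [e1, hB2, div_le_iff₀ (by positivity)] at hfin
  have e2 : 8 * (c₁ / (400 * q ^ 3) * √N) * (16 * q ^ 3 * X) = 8 / 25 * c₁ * (√N * X) := by
    field_simp; norm_num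
  rw [e2] at hfin
  have h3 : √(N : ℝ) * X ≤ 3 * N := by
    calc √(N : ℝ) * X ≤ √N * (3 * √N) := by gcongr
      _ = 3 * N := by rw [mul_left_comm, Real.mul_self_sqrt hN0.le]
  have h4 : 8 / 25 * c₁ * (√N * X) ≤ 8 / 25 * c₁ * (3 * N) := by gcongr
  have h5 : 0 < c₁ * N := by positivity
  linarith
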